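/- Let $a>0$, let $\alpha\in\mathbb R$, put $k_n:=\frac{n\pi}{2a}$, and assume $|\alpha|\neq k_n$ for every integer $n\ge 1$. In $L^2(-a,a)$, with inner product $\langle\cdot,\cdot\rangle$ antilinear in the first component, let $$H\psi=-\psi'',\qquad \mathrm{Dom}(H)=\{\psi\in W^{2,2}(-a,a):\ \psi'(\pm a)+i\alpha\,\psi(\pm a)=0\}.$$ Let $\chi_0^N:=\frac1{\sqrt{2a}}$, $\chi_n^N(x):=\frac1{\sqrt a}\cos k_n(x+a)$, $\chi_n^D(x):=\frac1{\sqrt a}\sin k_n(x+a)$ for $n\ge1$, and put $$\phi_0(x)=\tfrac1{\sqrt{2a}}e^{i\alpha(x+a)},\qquad \phi_n=\chi_n^N+i\tfrac{\alpha}{k_n}\chi_n^D\quad(n\ge1),$$ $$\psi_0(x)=\frac{\alpha e^{2i\alpha a}\sqrt{2a}}{\sin(2\alpha a)}e^{-i\alpha(x+a)},\qquad \psi_n=\frac{k_n^2}{k_n^2-\alpha^2}\Big(\chi_n^N-i\tfrac{\alpha}{k_n}\chi_n^D\Big)\quad(n\ge1),$$ where, here and below, expressions that are undefined at $\alpha=0$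 are replaced by their limits as $\alpha\to0$. With $\lambda_0=\alpha^2$ and $\lambda_n=k_n^2$ for $n\ge 1$, one has $H\psi_n=\lambda_n\psi_n$, $H^*\phi_n=\lambda_n\phi_n$ and $\langle\psi_n,\phi_m\rangle=\delta_{nm}$ for all $m,n\ge0$. There is a bounded operator $\Omega$ on $L^2(-a,a)$ with bounded inverse such that, with strong convergence of the series, $$\Omega=\sum_{n=0}^\infty\chi_n^N\langle\phi_n,\cdot\rangle,\qquad \Omega^{-1}=\sum_{n=0}^\infty\psi_n\langle\chi_n^N,\cdot\rangle,$$ and the following hold. 1. $\Omega=I+L$ and $\Omega^{-1}=I+M$, where $L$ and $M$ are Hilbert–Schmidt integral operators with kernels $$\mathcal L(x,y)=\frac{i\alpha}{2a}\big[y-a\,\mathrm{sgn}(y-x)\big]+\frac1{2a}\big(e^{-i\alpha(y+a)}-1\big),$$ $$\mathcal M(x,y)=\frac{\alpha e^{i\alpha(a-x)}}{\sin(2\alpha a)}-\frac\alpha2e^{-i\alpha(x-y)}\big[\cot(2\alpha a)-i\,\mathrm{sgn}(y-x)\big]-\frac{\alpha e^{-i\alpha(x+y)}}{2\sin(2\alpha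 a)}.$$ 2. The operator $h:=\Omega H\Omega^{-1}$ is self-adjoint and equals the Neumann Laplacian plus a rank-one term: $$h\psi=-\psi''+\alpha^2\chi_0^N\langle\chi_0^N,\psi\rangle,\qquad \mathrm{Dom}(h)=\{\psi\in W^{2,2}(-a,a):\ \psi'(\pm a)=0\}.$$ Moreover $h\chi_n^N=\lambda_n\chi_n^N$ for every $n\ge0$. 3. $h$ is the operator associated with the densely defined closed sesquilinear form $t_h$ with domain $W^{1,2}(-a,a)$ whose quadratic form is $$t_h[\psi]=\|\psi'\|^2+\alpha^2|\langle\chi_0^N,\psi\rangle|^2;$$ that is, $\psi\in\mathrm{Dom}(h)$ and $h\psi=w$ hold if and only if $\psi\in W^{1,2}(-a,a)$ and $t_h(v,\psi)=\langle v,w\rangle$ for all $v\in W^{1,2}(-a,a)$. -/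

import Mathlib

open MeasureTheory Set Filter Topology

noncomputable section

namespace RobinInterval

/-- Lebesgue measure on the interval `(-a, a)`. -/
abbrev mu (a : ℝ) : Measure ℝ := volume.restrict (Ioo (-a) a)

/-- The Hilbert space `L²(-a, a)`; its inner product is antilinear in the first component. -/
abbrev L2 (a : ℝ) : Type := Lp ℂ 2 (mu a)

/-! ### Weak derivatives and Sobolev spaces -/

/-- Real test functions on `(-a, a)`: smooth, with compact support inside the interval. -/
def IsTest (a : ℝ) (θ : ℝ → ℝ) : Prop :=
  ContDiff ℝ ((⊤ : ℕ∞) : WithTop ℕ∞) θ ∧ HasCompactSupport θ ∧ tsupport θ ⊆ Ioo (-a) a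

/-- `g ∈ L²(-a, a)` is the weak derivative of `f ∈ L²(-a, a)`. -/
def IsWeakDeriv (a : ℝ) (f g : L2 a) : Prop :=
  ∀ θ : ℝ → ℝ, IsTest a θ →
    ∫ x, ((deriv θ x : ℝ) : ℂ) * f x ∂(mu a) = -∫ x, ((θ x : ℝ) : ℂ) * g x ∂(mu a)

theorem integrable_test_mul {a : ℝ} {θ : ℝ → ℝ} (hθ : Continuous θ) (hs : HasCompactSupport θ)
    (f : L2 a) : Integrable (fun x => ((θ x : ℝ) : ℂ) * f x) (mu a) := by
  obtain ⟨C, hC⟩ := hθ.bounded_above_of_compact_support hs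
  have hf : Integrable f (mu a) := (Lp.memLp f).integrable (by norm_num)
  refine hf.bdd_mul (c := C) (Complex.continuous_ofReal.comp hθ).aestronglyMeasurable ?_
  exact Eventually.of_forall fun x => by simpa using hC x

theorem IsTest.integrable {a : ℝ} {θ : ℝ → ℝ} (h : IsTest a θ) (f : L2 a) :
    Integrable (fun x => ((θ x : ℝ) : ℂ) * f x) (mu a) :=
  integrable_test_mul h.1.continuous h.2.1 f

theorem IsTest.integrable_deriv {a : ℝ} {θ : ℝ → ℝ} (h : IsTest a θ) (f : L2 a) :
    Integrable (fun x => ((deriv θ x : ℝ) : ℂ) * f x) (mu a) :=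
  integrable_test_mul (h.1.continuous_deriv (by norm_num)) h.2.1.deriv f

theorem integral_mul_add {a : ℝ} {θ : ℝ → ℝ}
    (h : ∀ f : L2 a, Integrable (fun x => ((θ x : ℝ) : ℂ) * f x) (mu a)) (f g : L2 a) :
    ∫ x, ((θ x : ℝ) : ℂ) * (f + g : L2 a) x ∂(mu a)
      = ∫ x, ((θ x : ℝ) : ℂ) * f x ∂(mu a) + ∫ x, ((θ x : ℝ) : ℂ) * g x ∂(mu a) := by
  rw [← integral_add (h f) (h g)]
  refine integral_congr_ae ?_
  filter_upwards [Lp.coeFn_add f g] with x hx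
  rw [hx, Pi.add_apply, mul_add]

theorem integral_mul_smul {a : ℝ} {θ : ℝ → ℝ} (c : ℂ) (f : L2 a) :
    ∫ x, ((θ x : ℝ) : ℂ) * (c • f : L2 a) x ∂(mu a) = c * ∫ x, ((θ x : ℝ) : ℂ) * f x ∂(mu a) := by
  rw [← integral_const_mul]
  refine integral_congr_ae ?_
  filter_upwards [Lp.coeFn_smul c f] with x hx
  rw [hx, Pi.smul_apply, smul_eq_mul]
  ring

theorem IsWeakDeriv.add {a : ℝ} {f g f' g' : L2 a} (h : IsWeakDeriv a f f')
    (h' : IsWeakDeriv a g g') : IsWeakDeriv a (f + g) (f' + g') := by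
  intro θ hθ
  rw [integral_mul_add hθ.integrable_deriv, integral_mul_add hθ.integrable, h θ hθ, h' θ hθ]
  ring

theorem IsWeakDeriv.smul {a : ℝ} {f f' : L2 a} (c : ℂ) (h : IsWeakDeriv a f f') :
    IsWeakDeriv a (c • f) (c • f') := by
  intro θ hθ
  rw [integral_mul_smul, integral_mul_smul, h θ hθ]
  ring

theorem isWeakDeriv_zero (a : ℝ) : IsWeakDeriv a 0 0 := by
  intro θ hθ
  have h0 : (0 : L2 a) = (0 : ℂ) • 0 := by simp
  rw [h0, integral_mul_smul, integral_mul_smul]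
  simp

theorem IsWeakDeriv.eq_zero {a : ℝ} {g : L2 a} (h : IsWeakDeriv a 0 g) : g = 0 := by
  have hg : IntegrableOn g (Ioo (-a) a) volume := (Lp.memLp g).integrable (by norm_num)
  have key := isOpen_Ioo.ae_eq_zero_of_integral_contDiff_smul_eq_zero
    (U := Ioo (-a) a) hg.locallyIntegrableOn (by
      intro θ h1 h2 h3
      have hθ : IsTest a θ := ⟨h1, h2, h3⟩
      have e := h θ hθ
      have h0 : (0 : L2 a) = (0 : ℂ) • 0 := by simp
      rw [h0, integral_mul_smul, zero_mul, eq_comm, neg_eq_zero] at e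
      rw [← e, ← setIntegral_eq_integral_of_forall_compl_eq_zero (s := Ioo (-a) a)]
      · refine integral_congr_ae (Eventually.of_forall fun x => ?_)
        simp
      · intro x hx
        have : θ x = 0 := by
          by_contra hne
          exact hx (h3 (subset_tsupport θ hne))
        simp [this])
  have : ∀ᵐ x ∂(mu a), g x = 0 := by
    rw [ae_restrict_iff' measurableSet_Ioo]
    exact key
  refine Lp.ext ?_
  filter_upwards [this, Lp.coeFn_zero ℂ 2 (mu a)] with x hx hx0
  rw [hx, hx0, Pi.zero_apply]

/-- The graph `{(ψ, ψ') : ψ ∈ W^{1,2}(-a, a)}` of the weak derivative. -/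
def weakDerivGraph (a : ℝ) : Submodule ℂ (L2 a × L2 a) where
  carrier := {p | IsWeakDeriv a p.1 p.2}
  add_mem' h h' := IsWeakDeriv.add h h'
  zero_mem' := isWeakDeriv_zero a
  smul_mem' c _ h := IsWeakDeriv.smul c h

/-- The operator `ψ ↦ ψ'` (weak derivative) in `L²(-a, a)`, with domain `W^{1,2}(-a, a)`. -/
def weakDeriv (a : ℝ) : L2 a →ₗ.[ℂ] L2 a := (weakDerivGraph a).toLinearPMap

/-- The Sobolev space `W^{1,2}(-a, a)`. -/
abbrev W12 (a : ℝ) : Submodule ℂ (L2 a) := (weakDeriv a).domain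

theorem weakDeriv_graph (a : ℝ) : (weakDeriv a).graph = weakDerivGraph a := by
  refine Submodule.toLinearPMap_graph_eq _ ?_
  rintro ⟨f, g⟩ hx rfl
  exact IsWeakDeriv.eq_zero hx

theorem mem_W12_iff {a : ℝ} {f : L2 a} : f ∈ W12 a ↔ ∃ g : L2 a, IsWeakDeriv a f g := by
  rw [LinearPMap.mem_domain_iff, weakDeriv_graph]
  rfl

/-- `u` is a representative of `f` that is continuous on `[-a, a]`.
Boundary values of Sobolev functions are those of this representative. -/
def IsContRep (a : ℝ) (f : L2 a) (u : ℝ → ℂ) : Prop :=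
  ContinuousOn u (Icc (-a) a) ∧ f =ᵐ[mu a] u

/-! ### The Robin operator -/

/-- The graph of the Robin operator: the pairs `(ψ, -ψ'')` with `ψ ∈ W^{2,2}(-a, a)` and
`ψ'(a) + c₊ ψ(a) = 0`, `ψ'(-a) + c₋ ψ(-a) = 0`. -/
def robinGraph (a : ℝ) (cm cp : ℂ) : Submodule ℂ (L2 a × L2 a) where
  carrier := {p | ∃ ψ' : L2 a, IsWeakDeriv a p.1 ψ' ∧ IsWeakDeriv a ψ' (-p.2) ∧
    ∃ u v : ℝ → ℂ, IsContRep a p.1 u ∧ IsContRep a ψ' v ∧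
      v a + cp * u a = 0 ∧ v (-a) + cm * u (-a) = 0}
  add_mem' := by
    rintro ⟨f, g⟩ ⟨f₁, g₁⟩ ⟨d, h1, h2, u, v, hu, hv, b1, b2⟩
      ⟨d₁, k1, k2, u₁, v₁, hu₁, hv₁, b3, b4⟩
    refine ⟨d + d₁, h1.add k1, ?_, u + u₁, v + v₁, ⟨hu.1.add hu₁.1, ?_⟩,
      ⟨hv.1.add hv₁.1, ?_⟩, ?_, ?_⟩
    · have e : -(g + g₁) = -g + -g₁ := by abel
      show IsWeakDeriv a (d + d₁) (-(g + g₁))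
      rw [e]
      exact h2.add k2
    · exact (Lp.coeFn_add f f₁).trans (hu.2.add hu₁.2)
    · exact (Lp.coeFn_add d d₁).trans (hv.2.add hv₁.2)
    · simp only [Pi.add_apply]
      linear_combination b1 + b3
    · simp only [Pi.add_apply]
      linear_combination b2 + b4
  zero_mem' := by
    refine ⟨0, isWeakDeriv_zero a, ?_, 0, 0, ⟨continuousOn_const, Lp.coeFn_zero _ _ _⟩,
      ⟨continuousOn_const, Lp.coeFn_zero _ _ _⟩, by simp, by simp⟩
    show IsWeakDeriv a 0 (-0)
    rw [neg_zero]
    exact isWeakDeriv_zero a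
  smul_mem' := by
    rintro c ⟨f, g⟩ ⟨d, h1, h2, u, v, hu, hv, b1, b2⟩
    refine ⟨c • d, h1.smul c, ?_, c • u, c • v, ⟨hu.1.const_smul c, ?_⟩,
      ⟨hv.1.const_smul c, ?_⟩, ?_, ?_⟩
    · show IsWeakDeriv a (c • d) (-(c • g))
      rw [← smul_neg]
      exact h2.smul c
    · exact (Lp.coeFn_smul c f).trans (hu.2.const_smul c)
    · exact (Lp.coeFn_smul c d).trans (hv.2.const_smul c)
    · simp only [Pi.smul_apply, smul_eq_mul]
      linear_combination c * b1
    · simp only [Pi.smul_apply, smul_eq_mul]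
      linear_combination c * b2

/-- The operator `H ψ = -ψ''` with domain
`{ψ ∈ W^{2,2}(-a, a) : ψ'(± a) + c_± ψ(± a) = 0}`. -/
def robin (a : ℝ) (cm cp : ℂ) : L2 a →ₗ.[ℂ] L2 a := (robinGraph a cm cp).toLinearPMap

theorem robin_graph (a : ℝ) (cm cp : ℂ) : (robin a cm cp).graph = robinGraph a cm cp := by
  refine Submodule.toLinearPMap_graph_eq _ ?_
  rintro ⟨f, g⟩ ⟨d, h1, h2, -⟩ rfl
  have hd : d = 0 := IsWeakDeriv.eq_zero h1
  subst hd
  exact neg_eq_zero.1 (IsWeakDeriv.eq_zero h2)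

/-- The Neumann Laplacian `-Δ_N`: the case `c_± = 0`. -/
def neumannLaplacian (a : ℝ) : L2 a →ₗ.[ℂ] L2 a := robin a 0 0

/-! ### Eigenfunctions -/

theorem memLp_of_continuous (a : ℝ) {f : ℝ → ℂ} (hf : Continuous f) : MemLp f 2 (mu a) := by
  obtain ⟨C, hC⟩ := (isCompact_Icc (a := -a) (b := a)).exists_bound_of_continuousOn hf.continuousOn
  refine MemLp.of_bound hf.aestronglyMeasurable C ?_
  exact (ae_restrict_iff' measurableSet_Ioo).2
    (Eventually.of_forall fun x hx => hC x (Ioo_subset_Icc_self hx))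

/-- The class in `L²(-a, a)` of a continuous function. -/
def ofCont (a : ℝ) (f : ℝ → ℂ) (hf : Continuous f) : L2 a := (memLp_of_continuous a hf).toLp f

/-- `k_n = n π / (2 a)`. -/
def k (a : ℝ) (n : ℕ) : ℝ := n * Real.pi / (2 * a)

/-- `χ_n^N` as a function. -/
def chiNFun (a : ℝ) (n : ℕ) (x : ℝ) : ℂ :=
  if n = 0 then ((1 / √(2 * a) : ℝ) : ℂ) else ((1 / √a * Real.cos (k a n * (x + a)) : ℝ) : ℂ)

/-- `χ_n^D` as a function; it vanishes identically for `n = 0`. -/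
def chiDFun (a : ℝ) (n : ℕ) (x : ℝ) : ℂ := ((1 / √a * Real.sin (k a n * (x + a)) : ℝ) : ℂ)

/-- `A_0 = α e^{2 i α a} √(2 a) / sin (2 α a)`, and its limit `1 / √(2 a)` for `α = 0`. -/
def A0 (a α : ℝ) : ℂ :=
  if α = 0 then ((1 / √(2 * a) : ℝ) : ℂ)
  else α * Complex.exp (2 * Complex.I * α * a) * (√(2 * a) : ℝ) / Complex.sin (2 * α * a)

/-- The eigenfunctions `ψ_n` of `H` for `c_± = i α`, as functions. -/
def psiFun (a α : ℝ) (n : ℕ) (x : ℝ) : ℂ :=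
  if n = 0 then A0 a α * Complex.exp (-(Complex.I * α * (x + a)))
  else (((k a n) ^ 2 / ((k a n) ^ 2 - α ^ 2) : ℝ) : ℂ) *
    (chiNFun a n x - Complex.I * ((α / k a n : ℝ) : ℂ) * chiDFun a n x)

/-- The eigenfunctions `φ_n` of `H*` for `c_± = i α`, as functions. -/
def phiFun (a α : ℝ) (n : ℕ) (x : ℝ) : ℂ :=
  if n = 0 then ((1 / √(2 * a) : ℝ) : ℂ) * Complex.exp (Complex.I * α * (x + a))
  else chiNFun a n x + Complex.I * ((α / k a n : ℝ) : ℂ) * chiDFun a n x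

theorem continuous_chiNFun (a : ℝ) (n : ℕ) : Continuous (chiNFun a n) := by
  unfold chiNFun
  split_ifs <;> fun_prop

theorem continuous_chiDFun (a : ℝ) (n : ℕ) : Continuous (chiDFun a n) := by
  unfold chiDFun
  fun_prop

theorem continuous_psiFun (a α : ℝ) (n : ℕ) : Continuous (psiFun a α n) := by
  have h1 := continuous_chiNFun a n
  have h2 := continuous_chiDFun a n
  unfold psiFun
  split_ifs <;> fun_prop

theorem continuous_phiFun (a α : ℝ) (n : ℕ) : Continuous (phiFun a α n) := by
  have h1 := continuous_chiNFun a n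
  have h2 := continuous_chiDFun a n
  unfold phiFun
  split_ifs <;> fun_prop

/-- `χ_n^N ∈ L²(-a, a)`. -/
def chiN (a : ℝ) (n : ℕ) : L2 a := ofCont a (chiNFun a n) (continuous_chiNFun a n)

/-- `ψ_n ∈ L²(-a, a)`. -/
def psi (a α : ℝ) (n : ℕ) : L2 a := ofCont a (psiFun a α n) (continuous_psiFun a α n)

/-- `φ_n ∈ L²(-a, a)`. -/
def phi (a α : ℝ) (n : ℕ) : L2 a := ofCont a (phiFun a α n) (continuous_phiFun a α n)

/-- The eigenvalues `λ_0 = α²` and `λ_n = k_n²` for `n ≥ 1`. -/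
def eig (a α : ℝ) (n : ℕ) : ℝ := if n = 0 then α ^ 2 else (k a n) ^ 2

/-! ### Integral operators -/

/-- `T` is the Hilbert-Schmidt integral operator in `L²(-a, a)` with kernel `K`. -/
def IsIntegralOperator (a : ℝ) (T : L2 a →L[ℂ] L2 a) (K : ℝ → ℝ → ℂ) : Prop :=
  MemLp (Function.uncurry K) 2 ((mu a).prod (mu a)) ∧
    ∀ f : L2 a, T f =ᵐ[mu a] fun x => ∫ y, K x y * f y ∂(mu a)

/-- The kernel `𝓛(x, y)`. -/
def kernelL (a α x y : ℝ) : ℂ :=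
  Complex.I * α / (2 * a) * (y - a * Real.sign (y - x))
    + 1 / (2 * a) * (Complex.exp (-(Complex.I * α * (y + a))) - 1)

/-- The kernel `𝓜(x, y)`; for `α = 0` it is read as its limit `0` as `α → 0`. -/
def kernelM (a α x y : ℝ) : ℂ :=
  if α = 0 then 0
  else α * Complex.exp (Complex.I * α * (a - x)) / Complex.sin (2 * α * a)
    - α / 2 * Complex.exp (-(Complex.I * α * (x - y))) *
        (Complex.cot (2 * α * a) - Complex.I * Real.sign (y - x))
    - α * Complex.exp (-(Complex.I * α * (x + y))) / (2 * Complex.sin (2 * α * a))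

/-! ### Similar operators and quadratic forms -/

/-- The operator `Ω T Ω⁻¹`, with domain `{u : Ω⁻¹ u ∈ Dom T}`. -/
def similar {E : Type*} [NormedAddCommGroup E] [NormedSpace ℂ E] (Ω : E ≃L[ℂ] E)
    (T : E →ₗ.[ℂ] E) : E →ₗ.[ℂ] E where
  domain := T.domain.comap (Ω.symm : E →ₗ[ℂ] E)
  toFun :=
    { toFun := fun u => Ω (T ⟨Ω.symm u, u.2⟩)
      map_add' := fun u v => by
        rw [← map_add Ω, ← LinearPMap.map_add]
        refine congrArg Ω (congrArg T (Subtype.ext ?_))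
        exact map_add Ω.symm (u : E) (v : E)
      map_smul' := fun c u => by
        rw [RingHom.id_apply, ← map_smul Ω, ← LinearPMap.map_smul]
        refine congrArg Ω (congrArg T (Subtype.ext ?_))
        exact map_smul Ω.symm c (u : E) }

/-- The Neumann Laplacian plus the bounded rank-one operator
`α² χ_0^N ⟨χ_0^N, ·⟩`, with the domain of the Neumann Laplacian. -/
def hOp (a α : ℝ) : L2 a →ₗ.[ℂ] L2 a :=
  (((α : ℂ) ^ 2 • InnerProductSpace.rankOne ℂ (chiN a 0) (chiN a 0) : L2 a →L[ℂ] L2 a) :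
    L2 a →ₗ[ℂ] L2 a) +ᵥ neumannLaplacian a

/-- A sesquilinear form on a domain `D`, antilinear in the first component. -/
abbrev SesqForm {E : Type*} [NormedAddCommGroup E] [NormedSpace ℂ E] (D : Submodule ℂ E) :=
  D →ₗ⋆[ℂ] D →ₗ[ℂ] ℂ

/-- Closedness of a form: if `u_n → x` in the Hilbert space and `t[u_n - u_m] → 0`, then `x` lies
in the form domain and `t[u_n - x] → 0`. -/
def IsClosedForm {E : Type*} [NormedAddCommGroup E] [NormedSpace ℂ E] {D : Submodule ℂ E}
    (t : SesqForm D) : Prop :=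
  ∀ (u : ℕ → D) (x : E), Tendsto (fun n => (u n : E)) atTop (𝓝 x) →
    Tendsto (fun p : ℕ × ℕ => t (u p.1 - u p.2) (u p.1 - u p.2)) atTop (𝓝 0) →
    ∃ hx : x ∈ D, Tendsto (fun n => t (u n - ⟨x, hx⟩) (u n - ⟨x, hx⟩)) atTop (𝓝 0)

/-- `T` is the operator associated with the form `t`: `u ∈ Dom T` and `T u = w` hold exactly when
`u` lies in the form domain and `t(v, u) = ⟨v, w⟩` for all `v` in the form domain. -/
def IsAssociatedOperator {E : Type*} [NormedAddCommGroup E] [InnerProductSpace ℂ E]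
    {D : Submodule ℂ E} (t : SesqForm D) (T : E →ₗ.[ℂ] E) : Prop :=
  ∀ u w : E, (u, w) ∈ T.graph ↔ ∃ hu : u ∈ D, ∀ v : D, t v ⟨u, hu⟩ = inner ℂ (v : E) w

end RobinInterval

end

/-! The map `Ω` trades the Robin condition for the Neumann one. For `ψ` in `W^{1,2}` it satisfies
`(Ωψ)' = ψ' + iαψ`, so `ψ' + iαψ` vanishes at an endpoint exactly when `(Ωψ)'` does. The constant of
integration left open is fixed by `⟨χ_0, Ωψ⟩ = ⟨φ_0, ψ⟩`. Accordingly `Ω` and its inverse are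
constructed from the kernels, not from the series. The operator `S` with kernel `𝓛` satisfies `(Sf)'
= iαf` and `⟨χ_0, f + Sf⟩ = ⟨φ_0, f⟩` (`exists_operator_kernelL`). The operator `T` with kernel `𝓜`
satisfies `(Tf)' = -iα(f + Tf)` and `⟨φ_0, f + Tf⟩ = ⟨χ_0, f⟩` (`exists_operator_kernelM`). A
function with zero derivative and zero mean is zero, hence `(I+S)(I+T) = I`. The solutions of `f' =
-iαf` are multiples of `ψ_0`, and `⟨φ_0, ψ_0⟩ = 1`, hence `I+S` is injective and the inverse is
two-sided. The same uniqueness argument gives `Ωψ_n = χ_n` from `ψ_n' = -k_n χ_n^D - iαψ_n`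
(`exists_similarity`). The series follow from completeness of the cosines
(`eq_zero_of_inner_chiN_eq_zero`): applying `Ω⁻¹` to the Neumann expansion gives the series of
`Ω⁻¹`, and biorthogonality turns the coefficients `⟨χ_n, Ωf⟩` into `⟨φ_n, f⟩`. The operator `h` is
diagonal: `(u, w)` lies in its graph iff `⟨χ_n, w⟩ = λ_n ⟨χ_n, u⟩` for all `n`
(`mem_hOp_graph_iff_inner`). Self-adjointness, the inclusion of `ΩHΩ⁻¹` in `h`, and the recovery of
`h` from its form are all read off from these coefficients. The analytic basis is the identification
of weak derivatives with primitives, which yields boundary values and integration by parts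
(`inner_weakDeriv_add`). -/

noncomputable section

namespace RobinInterval

/-! ### Primitives on the interval -/

/-- `u` is, on `[-a, a]`, a primitive of the integrable function `g`. -/
structure HasPrim (a : ℝ) (u g : ℝ → ℂ) : Prop where
  intervalIntegrable : IntervalIntegrable g volume (-a) a
  eq : ∀ x ∈ Icc (-a) a, u x = u (-a) + ∫ t in (-a)..x, g t

theorem ae_mu_mem (a : ℝ) : ∀ᵐ x ∂(mu a), x ∈ Icc (-a) a := by
  filter_upwards [ae_restrict_mem (measurableSet_Ioo (a := -a) (b := a))] with x hx
  exact Ioo_subset_Icc_self hx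

theorem integral_mu {a : ℝ} (ha : 0 < a) (f : ℝ → ℂ) :
    ∫ x, f x ∂(mu a) = ∫ x in (-a)..a, f x := by
  rw [intervalIntegral.integral_of_le (by linarith), integral_Ioc_eq_integral_Ioo]

theorem intervalIntegrable_iff_mu {a : ℝ} (ha : 0 < a) {f : ℝ → ℂ} :
    IntervalIntegrable f volume (-a) a ↔ Integrable f (mu a) := by
  rw [intervalIntegrable_iff_integrableOn_Ioo_of_le (by linarith), IntegrableOn]

theorem intervalIntegrable_coe {a : ℝ} (ha : 0 < a) (f : L2 a) :
    IntervalIntegrable f volume (-a) a :=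
  (intervalIntegrable_iff_mu ha).2 ((Lp.memLp f).integrable (by norm_num))

theorem intervalIntegral_congr_mu {a : ℝ} {f g : ℝ → ℂ} (h : f =ᵐ[mu a] g)
    {x : ℝ} (hx : x ∈ Icc (-a) a) : ∫ t in (-a)..x, f t = ∫ t in (-a)..x, g t := by
  rw [intervalIntegral.integral_of_le hx.1, intervalIntegral.integral_of_le hx.1,
    integral_Ioc_eq_integral_Ioo, integral_Ioc_eq_integral_Ioo]
  exact integral_congr_ae (ae_restrict_of_ae_restrict_of_subset (Ioo_subset_Ioo_right hx.2) h)

theorem intervalIntegrable_to {a : ℝ} {g : ℝ → ℂ} (hg : IntervalIntegrable g volume (-a) a)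
    {x : ℝ} (hx : x ∈ Icc (-a) a) : IntervalIntegrable g volume (-a) x :=
  hg.mono_set (by
    rw [uIcc_of_le hx.1, uIcc_of_le (hx.1.trans hx.2)]
    exact Icc_subset_Icc_right hx.2)

/-- The real and imaginary parts of a complex primitive are real primitives, for which absolute
continuity is known. -/
theorem absolutelyContinuousOnInterval_primitive {g : ℝ → ℂ} {b c : ℝ}
    (hg : IntervalIntegrable g volume b c) (C : ℂ) :
    AbsolutelyContinuousOnInterval (fun x => C + ∫ t in b..x, g t) b c := by
  have hc (z : ℂ) : AbsolutelyContinuousOnInterval (fun _ : ℝ => z) b c :=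
    (LipschitzWith.const z).lipschitzOnWith.absolutelyContinuousOnInterval
  have hre : IntervalIntegrable (fun t => (g t).re) volume b c := ⟨hg.1.re, hg.2.re⟩
  have him : IntervalIntegrable (fun t => (g t).im) volume b c := ⟨hg.1.im, hg.2.im⟩
  have h1 := (hre.absolutelyContinuousOnInterval_intervalIntegral (c := b) left_mem_uIcc).smul
    (hc 1)
  have h2 := (him.absolutelyContinuousOnInterval_intervalIntegral (c := b) left_mem_uIcc).smul
    (hc Complex.I)
  have h3 := ((hc C).add (h1.add h2))
  refine (absolutelyContinuousOnInterval_iff _ _ _).2 fun ε hε => ?_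
  obtain ⟨δ, hδ, H⟩ := (absolutelyContinuousOnInterval_iff _ _ _).1 h3 ε hε
  refine ⟨δ, hδ, fun E hE hsum => lt_of_eq_of_lt ?_ (H E hE hsum)⟩
  have key : ∀ x ∈ uIcc b c, C + ∫ t in b..x, g t =
      C + ((∫ t in b..x, (g t).re) • (1 : ℂ) + (∫ t in b..x, (g t).im) • Complex.I) := by
    intro x hx
    have hgx : IntervalIntegrable g volume b x := hg.mono_set (uIcc_subset_uIcc_left hx)
    have e1 : ∫ t in b..x, (g t).re = (∫ t in b..x, g t).re := by
      have := Complex.reCLM.intervalIntegral_comp_comm hgx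
      simpa using this
    have e2 : ∫ t in b..x, (g t).im = (∫ t in b..x, g t).im := by
      have := Complex.imCLM.intervalIntegral_comp_comm hgx
      simpa using this
    rw [e1, e2]
    simp [Complex.re_add_im]
  refine Finset.sum_congr rfl fun i hi => ?_
  have hi' := hE.1 i hi
  simp only [Pi.add_apply, Pi.smul_apply']
  rw [key _ hi'.1, key _ hi'.2]

namespace HasPrim

variable {a : ℝ} {u v g h : ℝ → ℂ}

theorem of_hasDerivAt (hu : ∀ x, HasDerivAt u (g x) x) (hg : Continuous g) : HasPrim a u g where
  intervalIntegrable := hg.intervalIntegrable _ _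
  eq x _ := by
    rw [intervalIntegral.integral_eq_sub_of_hasDerivAt (fun y _ => hu y)
      (hg.intervalIntegrable _ _)]
    ring

theorem primitive (hg : IntervalIntegrable g volume (-a) a) (c : ℂ) :
    HasPrim a (fun x => c + ∫ t in (-a)..x, g t) g where
  intervalIntegrable := hg
  eq x _ := by simp

theorem conj (hu : HasPrim a u g) :
    HasPrim a (fun x => starRingEnd ℂ (u x)) (fun x => starRingEnd ℂ (g x)) where
  intervalIntegrable := by
    have := hu.1
    exact ⟨Complex.conjCLE.toContinuousLinearMap.integrable_comp this.1,
      Complex.conjCLE.toContinuousLinearMap.integrable_comp this.2⟩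
  eq x hx := by
    rw [hu.2 x hx, map_add]
    congr 1
    rw [intervalIntegral.integral_of_le hx.1, intervalIntegral.integral_of_le hx.1, integral_conj]

theorem congr_right (ha : 0 < a) (hu : HasPrim a u g) (hgh : g =ᵐ[mu a] h) : HasPrim a u h where
  intervalIntegrable :=
    (intervalIntegrable_iff_mu ha).2 (((intervalIntegrable_iff_mu ha).1 hu.1).congr hgh)
  eq x hx := by rw [hu.2 x hx, intervalIntegral_congr_mu hgh hx]

theorem continuousOn (hu : HasPrim a u g) : ContinuousOn u (Icc (-a) a) := by
  rcases le_or_gt (-a) a with h0 | h0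
  · have h1 := (absolutelyContinuousOnInterval_primitive hu.1 (u (-a))).continuousOn
    rw [uIcc_of_le h0] at h1
    exact h1.congr hu.2
  · simp [Icc_eq_empty_of_lt h0]

/-- The difference of `uv` and the primitive of `gv + uh` is absolutely continuous with derivative
zero almost everywhere, hence constant. Integration by parts rests on this product rule. -/
theorem mul (ha : 0 < a) (hu : HasPrim a u g) (hv : HasPrim a v h) :
    HasPrim a (fun x => u x * v x) (fun x => g x * v x + u x * h x) := by
  have hle : -a ≤ a := by linarith
  have huc : ContinuousOn u (uIcc (-a) a) := by rw [uIcc_of_le hle]; exact hu.continuousOn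
  have hvc : ContinuousOn v (uIcc (-a) a) := by rw [uIcc_of_le hle]; exact hv.continuousOn
  have hi : IntervalIntegrable (fun x => g x * v x + u x * h x) volume (-a) a :=
    (hu.1.mul_continuousOn hvc).add (hv.1.continuousOn_mul huc)
  refine ⟨hi, ?_⟩
  have hUac := absolutelyContinuousOnInterval_primitive hu.1 (u (-a))
  have hVac := absolutelyContinuousOnInterval_primitive hv.1 (v (-a))
  have hWac := absolutelyContinuousOnInterval_primitive hi 0
  have hac := (hUac.smul hVac).sub hWac
  have hder : ∀ᵐ x, x ∈ uIcc (-a) a →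
      HasDerivAt (((fun x => u (-a) + ∫ t in (-a)..x, g t) • fun x => v (-a) + ∫ t in (-a)..x, h t)
        - fun x => 0 + ∫ t in (-a)..x, (g t * v t + u t * h t)) 0 x := by
    filter_upwards [hu.1.ae_hasDerivAt_integral, hv.1.ae_hasDerivAt_integral,
      hi.ae_hasDerivAt_integral] with x h1 h2 h3 hx
    have d1 := (h1 hx (-a) left_mem_uIcc).const_add (u (-a))
    have d2 := (h2 hx (-a) left_mem_uIcc).const_add (v (-a))
    have d3 := (h3 hx (-a) left_mem_uIcc).const_add (0 : ℂ)
    have d4 := (d1.mul d2).sub d3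
    have hx' : x ∈ Icc (-a) a := by rwa [uIcc_of_le hle] at hx
    rw [← hu.2 x hx', ← hv.2 x hx', sub_self] at d4
    exact d4
  obtain ⟨C, hC⟩ := hac.const_of_ae_hasDerivAt_zero hder
  intro x hx
  have hx1 := hC x (by rwa [uIcc_of_le hle])
  have hx2 := hC (-a) left_mem_uIcc
  simp only [Pi.sub_apply, Pi.mul_apply, smul_eq_mul, ← hu.2 x hx,
    ← hv.2 x hx, intervalIntegral.integral_same] at hx1 hx2
  linear_combination hx1 - hx2

theorem integral_eq (ha : 0 < a) (hu : HasPrim a u g) : ∫ x, g x ∂(mu a) = u a - u (-a) := by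
  rw [integral_mu ha, hu.2 a (right_mem_Icc.2 (by linarith))]
  ring

end HasPrim

/-! ### Weak derivatives and primitives -/

variable {a : ℝ}

/-- Integrate the derivative of `θu` over the interval; the boundary terms vanish because `θ` is
supported inside. -/
theorem HasPrim.isWeakDeriv (ha : 0 < a) {u : ℝ → ℂ} {f g : L2 a} (hu : HasPrim a u g)
    (hf : f =ᵐ[mu a] u) : IsWeakDeriv a f g := by
  intro θ hθ
  have hd : ∀ x, HasDerivAt (fun y => ((θ y : ℝ) : ℂ)) ((deriv θ x : ℝ) : ℂ) x := fun x =>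
    ((hθ.1.differentiable (by simp)) x).hasDerivAt.ofReal_comp
  have hp : HasPrim a (fun y => ((θ y : ℝ) : ℂ)) (fun y => ((deriv θ y : ℝ) : ℂ)) :=
    HasPrim.of_hasDerivAt hd (Complex.continuous_ofReal.comp (hθ.1.continuous_deriv (by simp)))
  have h0 : ∀ x, x ∉ Ioo (-a) a → θ x = 0 := fun x hx =>
    image_eq_zero_of_notMem_tsupport fun h => hx (hθ.2.2 h)
  have key := (hp.mul ha hu).integral_eq ha
  have e : ∫ x, ((deriv θ x : ℝ) : ℂ) * f x ∂(mu a) = ∫ x, ((deriv θ x : ℝ) : ℂ) * u x ∂(mu a) := by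
    refine integral_congr_ae ?_
    filter_upwards [hf] with x hx
    rw [hx]
  have hint : Integrable (fun x => ((deriv θ x : ℝ) : ℂ) * u x) (mu a) := by
    refine (hθ.integrable_deriv f).congr ?_
    filter_upwards [hf] with x hx
    rw [hx]
  rw [integral_add hint (hθ.integrable g), h0 a (by simp), h0 (-a) (by simp)] at key
  rw [e]
  simp only [Complex.ofReal_zero, zero_mul, sub_zero] at key
  exact eq_neg_of_add_eq_zero_left key

/-- The primitive from `-a` vanishes to the left of the support of `η`, and to its right because the
total integral is zero. -/
theorem exists_isTest_primitive (ha : 0 < a) {η : ℝ → ℝ} (hη : IsTest a η)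
    (h0 : ∫ x in (-a)..a, η x = 0) : ∃ θ, IsTest a θ ∧ deriv θ = η := by
  have hc := hη.1.continuous
  have hd : ∀ x, HasDerivAt (fun y => ∫ t in (-a)..y, η t) (η x) x := fun x =>
    intervalIntegral.integral_hasDerivAt_right (hc.intervalIntegrable _ _)
      (hc.stronglyMeasurableAtFilter _ _) hc.continuousAt
  have hderiv : deriv (fun y => ∫ t in (-a)..y, η t) = η := funext fun x => (hd x).deriv
  -- A compact interval inside `(-a, a)` containing the support; it will also contain the support of
  -- the primitive.
  obtain ⟨b, c, hb, hcc, hbc⟩ : ∃ b c, -a < b ∧ c < a ∧ tsupport η ⊆ Icc b c := by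
    rcases (tsupport η).eq_empty_or_nonempty with h | h
    · exact ⟨0, 0, by linarith, ha, by simp [h]⟩
    · obtain ⟨b, hb⟩ := hη.2.1.isCompact.exists_isLeast h
      obtain ⟨c, hc⟩ := hη.2.1.isCompact.exists_isGreatest h
      exact ⟨b, c, (hη.2.2 hb.1).1, (hη.2.2 hc.1).2, fun x hx => ⟨hb.2 hx, hc.2 hx⟩⟩
  have hz : ∀ x, x ∉ Icc b c → η x = 0 := fun x hx =>
    image_eq_zero_of_notMem_tsupport fun h => hx (hbc h)
  have hsupp : tsupport (fun y => ∫ t in (-a)..y, η t) ⊆ Icc b c := by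
    refine closure_minimal ?_ isClosed_Icc
    intro x hx
    by_contra hxn
    refine hx ?_
    rcases lt_or_ge x b with h | h
    · refine intervalIntegral.integral_zero_ae (Eventually.of_forall fun t ht => hz t fun h' => ?_)
      rcases le_total (-a) x with h1 | h1
      · rw [uIoc_of_le h1] at ht
        linarith [ht.2, h'.1]
      · rw [uIoc_of_ge h1] at ht
        linarith [ht.2, h'.1]
    · have hcx : c < x := by
        by_contra h'
        exact hxn ⟨h, not_lt.1 h'⟩
      change ∫ t in (-a)..x, η t = 0
      rw [← intervalIntegral.integral_add_adjacent_intervals (hc.intervalIntegrable (-a) a)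
        (hc.intervalIntegrable a x), h0, zero_add]
      refine intervalIntegral.integral_zero_ae (Eventually.of_forall fun t ht => hz t fun h' => ?_)
      rcases le_total a x with h1 | h1
      · rw [uIoc_of_le h1] at ht
        linarith [ht.1, h'.2]
      · rw [uIoc_of_ge h1] at ht
        linarith [ht.1, h'.2]
  refine ⟨fun y => ∫ t in (-a)..y, η t, ⟨?_, ?_, hsupp.trans (Icc_subset_Ioo hb hcc)⟩, hderiv⟩
  · refine contDiff_infty_iff_deriv.2 ⟨fun x => (hd x).differentiableAt, ?_⟩
    rw [hderiv]
    exact hη.1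
  · exact HasCompactSupport.of_support_subset_isCompact isCompact_Icc
      ((subset_tsupport _).trans hsupp)

theorem exists_isTest_integral_eq_one (ha : 0 < a) :
    ∃ ρ, IsTest a ρ ∧ ∫ x in (-a)..a, ρ x = 1 := by
  let b : ContDiffBump (0 : ℝ) := ⟨a / 4, a / 2, by linarith, by linarith⟩
  have hsub : tsupport (b.normed volume) ⊆ Ioo (-a) a := by
    rw [b.tsupport_normed_eq, Real.closedBall_eq_Icc]
    refine Icc_subset_Ioo ?_ ?_ <;> simp [b] <;> linarith
  refine ⟨b.normed volume, ⟨b.contDiff_normed, b.hasCompactSupport_normed, hsub⟩, ?_⟩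
  rw [intervalIntegral.integral_of_le (by linarith), integral_Ioc_eq_integral_Ioo,
    setIntegral_eq_integral_of_forall_compl_eq_zero]
  · exact b.integral_normed
  · exact fun x hx => image_eq_zero_of_notMem_tsupport fun h => hx (hsub h)

/-- The hypothesis says that `g` is a weak derivative of `0`. -/
theorem ae_eq_zero_of_forall_isTest {g : L2 a}
    (h : ∀ θ, IsTest a θ → ∫ x, ((θ x : ℝ) : ℂ) * g x ∂(mu a) = 0) : g = 0 := by
  refine IsWeakDeriv.eq_zero (a := a) fun θ hθ => ?_
  have h0 : (0 : L2 a) = (0 : ℂ) • 0 := by simp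
  rw [h0, integral_mul_smul, h θ hθ]
  simp

/-- The constant functions in `L²(-a, a)`. -/
def const (a : ℝ) (c : ℂ) : L2 a := ofCont a (fun _ => c) continuous_const

theorem ofCont_ae (f : ℝ → ℂ) (hf : Continuous f) : ofCont a f hf =ᵐ[mu a] f :=
  (memLp_of_continuous a hf).coeFn_toLp

theorem integral_isTest_mul_const (ha : 0 < a) (θ : ℝ → ℝ) (c : ℂ) :
    ∫ x, ((θ x : ℝ) : ℂ) * const a c x ∂(mu a) = ((∫ x in (-a)..a, θ x : ℝ) : ℂ) * c := by
  have : ∫ x, ((θ x : ℝ) : ℂ) * const a c x ∂(mu a) = ∫ x, ((θ x : ℝ) : ℂ) * c ∂(mu a) := by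
    refine integral_congr_ae ?_
    filter_upwards [ofCont_ae (a := a) (fun _ => c) continuous_const] with x hx
    rw [const, hx]
  rw [this, integral_mu ha, intervalIntegral.integral_mul_const, intervalIntegral.integral_ofReal]

/-- Du Bois-Reymond: a function with vanishing weak derivative is constant. -/
theorem IsWeakDeriv.exists_eq_const (ha : 0 < a) {f : L2 a} (h : IsWeakDeriv a f 0) :
    ∃ c, f = const a c := by
  obtain ⟨ρ, hρ, hρ1⟩ := exists_isTest_integral_eq_one ha
  refine ⟨∫ x, ((ρ x : ℝ) : ℂ) * f x ∂(mu a), sub_eq_zero.1 (ae_eq_zero_of_forall_isTest ?_)⟩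
  set c := ∫ x, ((ρ x : ℝ) : ℂ) * f x ∂(mu a) with hc
  intro η hη
  have hsub : f - const a c = f + (-1 : ℂ) • const a c := by simp [sub_eq_add_neg]
  rw [hsub, integral_mul_add hη.integrable, integral_mul_smul, integral_isTest_mul_const ha]
  set s := ∫ x in (-a)..a, η x with hs
  -- Subtracting the multiple `s ρ` makes the mean zero, so that the difference is the derivative of
  -- a test function.
  have hηρ : IsTest a (fun x => η x - s * ρ x) := by
    refine ⟨hη.1.sub (contDiff_const.mul hρ.1), ?_, ?_⟩
    · exact hη.2.1.sub (hρ.2.1.mul_left)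
    · refine (tsupport_sub _ _).trans (union_subset hη.2.2 ?_)
      exact (tsupport_mul_subset_right).trans hρ.2.2
  obtain ⟨θ, hθ, hθd⟩ := exists_isTest_primitive ha hηρ (by
    rw [intervalIntegral.integral_sub (hη.1.continuous.intervalIntegrable _ _)
      ((hρ.1.continuous.intervalIntegrable _ _).const_mul s),
      intervalIntegral.integral_const_mul, hρ1]
    simp [hs])
  have key := h θ hθ
  have h0 : (0 : L2 a) = (0 : ℂ) • 0 := by simp
  rw [h0, integral_mul_smul, hθd, zero_mul, neg_zero] at key
  have e : ∀ x, ((η x - s * ρ x : ℝ) : ℂ) * f x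
      = ((η x : ℝ) : ℂ) * f x - (s : ℂ) * (((ρ x : ℝ) : ℂ) * f x) := fun x => by
    push_cast
    ring
  simp only [e] at key
  rw [integral_sub (hη.integrable f) ((hρ.integrable f).const_mul _), integral_const_mul,
    ← hc] at key
  linear_combination key

theorem exists_L2_of_hasPrim {u g : ℝ → ℂ} (hu : HasPrim a u g) :
    ∃ f : L2 a, f =ᵐ[mu a] u := by
  obtain ⟨C, hC⟩ := isCompact_Icc.exists_bound_of_continuousOn hu.continuousOn
  have hm : AEStronglyMeasurable u (mu a) :=
    (hu.continuousOn.mono Ioo_subset_Icc_self).aestronglyMeasurable measurableSet_Ioo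
  have : MemLp u 2 (mu a) := MemLp.of_bound hm C (by
    filter_upwards [ae_mu_mem a] with x hx using hC x hx)
  exact ⟨this.toLp u, this.coeFn_toLp⟩

/-- Functions with a weak derivative have a representative which is a primitive of it. -/
theorem IsWeakDeriv.exists_hasPrim (ha : 0 < a) {f g : L2 a} (h : IsWeakDeriv a f g) :
    ∃ u, HasPrim a u g ∧ f =ᵐ[mu a] u := by
  have hp := HasPrim.primitive (intervalIntegrable_coe ha g) 0
  obtain ⟨p, hpf⟩ := exists_L2_of_hasPrim hp
  -- The difference of `f` and a primitive of `g` has weak derivative zero, hence is constant.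
  have hw := h.add ((hp.isWeakDeriv ha hpf).smul (-1))
  have e : g + (-1 : ℂ) • g = 0 := by simp
  rw [e] at hw
  obtain ⟨c, hc⟩ := hw.exists_eq_const ha
  refine ⟨_, HasPrim.primitive (intervalIntegrable_coe ha g) c, ?_⟩
  have e2 : f = const a c + p := by rw [← hc]; simp
  rw [e2]
  filter_upwards [Lp.coeFn_add (const a c) p, hpf,
    ofCont_ae (a := a) (fun _ => c) continuous_const] with x h1 h2 h3
  rw [h1, Pi.add_apply, h2, const, h3]
  simp

/-- Boundary values do not depend on the chosen representative, since continuous functions that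
agree almost everywhere agree on the closed interval. -/
theorem IsContRep.eqOn (ha : 0 < a) {f : L2 a} {u v : ℝ → ℂ} (hu : IsContRep a f u)
    (hv : IsContRep a f v) : EqOn u v (Icc (-a) a) := by
  refine Measure.eqOn_Icc_of_ae_eq volume (by linarith) ?_ hu.1 hv.1
  rw [← Measure.restrict_congr_set (Ioo_ae_eq_Icc (a := -a) (b := a))]
  exact hu.2.symm.trans hv.2

theorem HasPrim.isContRep {u g : ℝ → ℂ} (hu : HasPrim a u g) {f : L2 a} (hf : f =ᵐ[mu a] u) :
    IsContRep a f u := ⟨hu.continuousOn, hf⟩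

/-! ### Inner products and integration by parts. -/

theorem inner_eq (f g : L2 a) : inner ℂ f g = ∫ x, starRingEnd ℂ (f x) * g x ∂(mu a) := by
  rw [L2.inner_def]
  exact integral_congr_ae (Eventually.of_forall fun x => by
    simp only [RCLike.inner_apply]; ring)

theorem integrable_conj_mul (f g : L2 a) :
    Integrable (fun x => starRingEnd ℂ (f x) * g x) (mu a) := by
  refine (L2.integrable_inner (𝕜 := ℂ) f g).congr (Eventually.of_forall fun x => ?_)
  change inner ℂ (f x) (g x) = _
  rw [RCLike.inner_apply]; ring

/-- Integration by parts. -/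
theorem inner_weakDeriv_add (ha : 0 < a) {f f' g g' : L2 a} {u v : ℝ → ℂ} (hf : IsWeakDeriv a f f')
    (hg : IsWeakDeriv a g g') (hu : IsContRep a f u) (hv : IsContRep a g v) :
    inner ℂ f' g + inner ℂ f g'
      = starRingEnd ℂ (u a) * v a - starRingEnd ℂ (u (-a)) * v (-a) := by
  obtain ⟨p, hp, hfp⟩ := hf.exists_hasPrim ha
  obtain ⟨q, hq, hgq⟩ := hg.exists_hasPrim ha
  have e1 := hu.eqOn ha (hp.isContRep hfp)
  have e2 := hv.eqOn ha (hq.isContRep hgq)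
  have hr : a ∈ Icc (-a) a := right_mem_Icc.2 (by linarith)
  have hl : -a ∈ Icc (-a) a := left_mem_Icc.2 (by linarith)
  rw [e1 hr, e1 hl, e2 hr, e2 hl, ← (hp.conj.mul ha hq).integral_eq ha, inner_eq, inner_eq,
    ← integral_add (integrable_conj_mul _ _) (integrable_conj_mul _ _)]
  refine integral_congr_ae ?_
  filter_upwards [hfp, hgq] with x h1 h2
  rw [h1, h2]

theorem isWeakDeriv_ofCont (ha : 0 < a) {u g : ℝ → ℂ} (hu : ∀ x, HasDerivAt u (g x) x)
    (huc : Continuous u) (hg : Continuous g) :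
    IsWeakDeriv a (ofCont a u huc) (ofCont a g hg) :=
  ((HasPrim.of_hasDerivAt hu hg).congr_right ha (ofCont_ae g hg).symm).isWeakDeriv ha
    (ofCont_ae u huc)

theorem isContRep_ofCont {u : ℝ → ℂ} (huc : Continuous u) : IsContRep a (ofCont a u huc) u :=
  ⟨huc.continuousOn, ofCont_ae u huc⟩

variable {α : ℝ}

/-! ### The Robin boundary value problem -/

/-- Integrating by parts twice leaves boundary terms that cancel because the two Robin constants are
conjugate. All orthogonality relations, and the fact that the `φ_n` are eigenvectors of the adjoint,
come from this identity. -/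
theorem robinGraph_inner (ha : 0 < a) {c : ℂ} {f g f₁ g₁ : L2 a} (h : (f, g) ∈ robinGraph a c c)
    (h₁ : (f₁, g₁) ∈ robinGraph a (starRingEnd ℂ c) (starRingEnd ℂ c)) :
    inner ℂ f₁ g = inner ℂ g₁ f := by
  obtain ⟨d, hd, hd2, u, v, hu, hv, b1, b2⟩ := h
  obtain ⟨d₁, hd₁, hd2₁, u₁, v₁, hu₁, hv₁, c1, c2⟩ := h₁
  have e1 := inner_weakDeriv_add ha hd₁ hd2 hu₁ hv
  have e2 := inner_weakDeriv_add ha hd2₁ hd hv₁ hu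
  simp only [inner_neg_right, inner_neg_left] at e1 e2
  have c1' := congrArg (starRingEnd ℂ) c1
  have c2' := congrArg (starRingEnd ℂ) c2
  simp only [map_add, map_mul, map_zero, Complex.conj_conj] at c1' c2'
  linear_combination e2 - e1 + u a * c1' - u (-a) * c2' - starRingEnd ℂ (u₁ a) * b1
    + starRingEnd ℂ (u₁ (-a)) * b2

theorem ofCont_mul (l : ℂ) {f : ℝ → ℂ} (hf : Continuous f) :
    l • ofCont a f hf = ofCont a (fun x => l * f x) (continuous_const.mul hf) := by
  refine Lp.ext ?_
  filter_upwards [Lp.coeFn_smul l (ofCont a f hf), ofCont_ae (a := a) f hf,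
    ofCont_ae (a := a) (fun x => l * f x) (continuous_const.mul hf)] with x h1 h2 h3
  rw [h1, h3, Pi.smul_apply, h2, smul_eq_mul]

theorem ofCont_mem_robinGraph (ha : 0 < a) {p q : ℝ → ℂ} {l c : ℂ}
    (hp : ∀ x, HasDerivAt p (q x) x) (hq : ∀ x, HasDerivAt q (-(l * p x)) x) (hpc : Continuous p)
    (h1 : q a + c * p a = 0) (h2 : q (-a) + c * p (-a) = 0) :
    (ofCont a p hpc, l • ofCont a p hpc) ∈ robinGraph a c c := by
  have hqc : Continuous q := continuous_iff_continuousAt.2 fun x => (hq x).continuousAt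
  refine ⟨ofCont a q hqc, isWeakDeriv_ofCont ha hp hpc hqc, ?_, p, q,
    isContRep_ofCont hpc, isContRep_ofCont hqc, h1, h2⟩
  have hc : Continuous fun x => -(l * p x) := (continuous_const.mul hpc).neg
  have := isWeakDeriv_ofCont ha hq hqc hc
  have e : -(l • ofCont a p hpc) = ofCont a (fun x => -(l * p x)) hc := by
    rw [← neg_smul, ofCont_mul]
    simp
  rwa [e]

theorem inner_ofCont {f g : ℝ → ℂ} (hf : Continuous f) (hg : Continuous g) :
    inner ℂ (ofCont a f hf) (ofCont a g hg) = ∫ x, starRingEnd ℂ (f x) * g x ∂(mu a) := by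
  rw [inner_eq]
  refine integral_congr_ae ?_
  filter_upwards [ofCont_ae (a := a) f hf, ofCont_ae (a := a) g hg] with x h1 h2
  rw [h1, h2]

theorem inner_ofCont_left {f : ℝ → ℂ} (hf : Continuous f) (g : L2 a) :
    inner ℂ (ofCont a f hf) g = ∫ x, starRingEnd ℂ (f x) * g x ∂(mu a) := by
  rw [inner_eq]
  refine integral_congr_ae ?_
  filter_upwards [ofCont_ae (a := a) f hf] with x h1
  rw [h1]

/-! ### The eigenfunctions -/

theorem k_zero : k a 0 = 0 := by simp [k]

theorem k_pos (ha : 0 < a) {n : ℕ} (hn : n ≠ 0) : 0 < k a n := by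
  unfold k
  have : 0 < (n : ℝ) := by positivity
  positivity

theorem k_mul_two (ha : 0 < a) (n : ℕ) : k a n * (a + a) = n * Real.pi := by
  unfold k
  field_simp
  ring

theorem k_injective (ha : 0 < a) : Function.Injective (k a) := by
  intro m n h
  unfold k at h
  have := Real.pi_pos
  field_simp at h
  exact_mod_cast h

theorem chiDFun_zero (x : ℝ) : chiDFun a 0 x = 0 := by simp [chiDFun, k_zero]

theorem hasDerivAt_chiNFun (n : ℕ) (x : ℝ) :
    HasDerivAt (chiNFun a n) (-(k a n * chiDFun a n x)) x := by
  by_cases hn : n = 0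
  · subst hn
    have : chiNFun a 0 = fun _ => ((1 / √(2 * a) : ℝ) : ℂ) := by ext; simp [chiNFun]
    rw [this, k_zero]
    simpa using hasDerivAt_const x ((1 / √(2 * a) : ℝ) : ℂ)
  · have h1 : HasDerivAt (fun x : ℝ => 1 / √a * Real.cos (k a n * (x + a)))
        (1 / √a * (-Real.sin (k a n * (x + a)) * (k a n * 1))) x :=
      ((((hasDerivAt_id x).add_const a).const_mul (k a n)).cos).const_mul _
    have h2 := h1.ofReal_comp
    have e : chiNFun a n = fun x => ((1 / √a * Real.cos (k a n * (x + a)) : ℝ) : ℂ) := by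
      ext; simp [chiNFun, hn]
    rw [e]
    convert h2 using 1
    simp only [chiDFun]
    push_cast
    ring

theorem hasDerivAt_chiDFun (n : ℕ) (x : ℝ) :
    HasDerivAt (chiDFun a n) (k a n * chiNFun a n x) x := by
  by_cases hn : n = 0
  · subst hn
    have : chiDFun a 0 = fun _ => 0 := by ext; simp [chiDFun_zero]
    rw [this, k_zero]
    simpa using hasDerivAt_const x (0 : ℂ)
  · have h1 : HasDerivAt (fun x : ℝ => 1 / √a * Real.sin (k a n * (x + a)))
        (1 / √a * (Real.cos (k a n * (x + a)) * (k a n * 1))) x :=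
      ((((hasDerivAt_id x).add_const a).const_mul (k a n)).sin).const_mul _
    have h2 := h1.ofReal_comp
    have e : chiDFun a n = fun x => ((1 / √a * Real.sin (k a n * (x + a)) : ℝ) : ℂ) := rfl
    rw [e]
    convert h2 using 1
    simp only [chiNFun, hn, if_false]
    push_cast
    ring

theorem chiDFun_right (ha : 0 < a) (n : ℕ) : chiDFun a n a = 0 := by
  simp [chiDFun, k_mul_two ha, Real.sin_nat_mul_pi]

theorem chiDFun_left (n : ℕ) : chiDFun a n (-a) = 0 := by
  simp [chiDFun]

theorem conj_chiNFun (n : ℕ) (x : ℝ) : starRingEnd ℂ (chiNFun a n x) = chiNFun a n x := by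
  unfold chiNFun
  split_ifs <;> exact Complex.conj_ofReal _

theorem conj_chiDFun (n : ℕ) (x : ℝ) : starRingEnd ℂ (chiDFun a n x) = chiDFun a n x :=
  Complex.conj_ofReal _

theorem chiN_mem_neumann (ha : 0 < a) (n : ℕ) :
    (chiN a n, ((k a n : ℂ) ^ 2) • chiN a n) ∈ robinGraph a 0 0 := by
  refine ofCont_mem_robinGraph ha (hasDerivAt_chiNFun n) (fun x => ?_) _ ?_ ?_
  · refine (((hasDerivAt_chiDFun n x).const_mul (k a n : ℂ)).neg).congr_deriv ?_
    ring
  · simp [chiDFun_right ha]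
  · simp [chiDFun_left]

/-- The function `χ_n^N + s χ_n^D` satisfies the Robin conditions with constant `-s k_n`. -/
theorem ofCont_chi_mem_robinGraph (ha : 0 < a) (n : ℕ) (r s c : ℂ) (hc : s * k a n = -c)
    (h : Continuous fun x => r * (chiNFun a n x + s * chiDFun a n x)) :
    (ofCont a _ h, ((k a n : ℂ) ^ 2) • ofCont a _ h) ∈ robinGraph a c c := by
  refine ofCont_mem_robinGraph ha (q := fun x => r * (-(k a n * chiDFun a n x)
    + s * (k a n * chiNFun a n x)))
    (fun x => ((hasDerivAt_chiNFun n x).fun_add ((hasDerivAt_chiDFun n x).const_mul s)).const_mul r)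
    (fun x => ?_) _ ?_ ?_
  · refine (((((hasDerivAt_chiDFun n x).const_mul (k a n : ℂ)).neg).add
      (((hasDerivAt_chiNFun n x).const_mul (k a n : ℂ)).const_mul s)).const_mul r).congr_deriv ?_
    ring
  · rw [chiDFun_right ha]
    linear_combination r * chiNFun a n a * hc
  · rw [chiDFun_left]
    linear_combination r * chiNFun a n (-a) * hc

/-- The derivative of the exponential is `s` times itself at every point, so the Robin condition
with constant `-s` holds at both ends. -/
theorem ofCont_exp_mem_robinGraph (ha : 0 < a) (r s : ℂ)
    (h : Continuous fun x : ℝ => r * Complex.exp (s * (x + a))) :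
    (ofCont a _ h, (-s ^ 2) • ofCont a _ h) ∈ robinGraph a (-s) (-s) := by
  have hd (x : ℝ) : HasDerivAt (fun x : ℝ => Complex.exp (s * (x + a)))
      (s * Complex.exp (s * (x + a))) x := by
    have h1 : HasDerivAt (fun x : ℝ => s * ((x : ℂ) + a)) (s * 1) x :=
      (((hasDerivAt_id x).ofReal_comp).add_const (a : ℂ)).const_mul s
    refine h1.cexp.congr_deriv ?_
    ring
  refine ofCont_mem_robinGraph ha (q := fun x : ℝ => r * (s * Complex.exp (s * (x + a))))
    (fun x => (hd x).const_mul r)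
    (fun x => (((hd x).const_mul s).const_mul r).congr_deriv ?_) _ ?_ ?_ <;> ring

theorem psi_mem_robinGraph (ha : 0 < a) (α : ℝ) (n : ℕ) :
    (psi a α n, (eig a α n : ℂ) • psi a α n)
      ∈ robinGraph a (Complex.I * α) (Complex.I * α) := by
  by_cases hn : n = 0
  · subst hn
    have e : psiFun a α 0 = fun x : ℝ => A0 a α * Complex.exp (-(Complex.I * α) * (x + a)) := by
      ext x
      simp [psiFun]
    have := ofCont_exp_mem_robinGraph ha (A0 a α) (-(Complex.I * α)) (e ▸ continuous_psiFun a α 0)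
    have e2 : (eig a α 0 : ℂ) = -(-(Complex.I * α)) ^ 2 := by
      simp [eig, mul_pow]
    have e3 : psi a α 0 = ofCont a _ (e ▸ continuous_psiFun a α 0) := by
      simp only [psi, e]
    rw [e2, e3]
    simpa using this
  · have hk := (k_pos ha hn).ne'
    have e : psiFun a α n = fun x : ℝ => (((k a n) ^ 2 / ((k a n) ^ 2 - α ^ 2) : ℝ) : ℂ) *
        (chiNFun a n x + (-(Complex.I * ((α / k a n : ℝ) : ℂ))) * chiDFun a n x) := by
      ext x
      simp only [psiFun, hn, if_false]
      ring
    have hk' : (k a n : ℂ) ≠ 0 := by exact_mod_cast hk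
    have := ofCont_chi_mem_robinGraph ha n _ _ (Complex.I * α)
      (by push_cast; field_simp) (e ▸ continuous_psiFun a α n)
    have e2 : (eig a α n : ℂ) = (k a n : ℂ) ^ 2 := by simp [eig, hn]
    have e3 : psi a α n = ofCont a _ (e ▸ continuous_psiFun a α n) := by
      simp only [psi, e]
    rw [e2, e3]
    exact this

theorem phi_mem_robinGraph (ha : 0 < a) (α : ℝ) (n : ℕ) :
    (phi a α n, (eig a α n : ℂ) • phi a α n)
      ∈ robinGraph a (-(Complex.I * α)) (-(Complex.I * α)) := by
  by_cases hn : n = 0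
  · subst hn
    have e : phiFun a α 0 = fun x : ℝ => ((1 / √(2 * a) : ℝ) : ℂ) *
        Complex.exp ((Complex.I * α) * (x + a)) := by
      ext x
      simp [phiFun]
    have := ofCont_exp_mem_robinGraph ha ((1 / √(2 * a) : ℝ) : ℂ) (Complex.I * α)
      (e ▸ continuous_phiFun a α 0)
    have e2 : (eig a α 0 : ℂ) = -(Complex.I * α) ^ 2 := by
      simp [eig, mul_pow]
    have e3 : phi a α 0 = ofCont a _ (e ▸ continuous_phiFun a α 0) := by
      simp only [phi, e]
    rw [e2, e3]
    exact this
  · have hk := (k_pos ha hn).ne'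
    have e : phiFun a α n = fun x : ℝ => (1 : ℂ) *
        (chiNFun a n x + (Complex.I * ((α / k a n : ℝ) : ℂ)) * chiDFun a n x) := by
      ext x
      simp only [phiFun, hn, if_false]
      ring
    have hk' : (k a n : ℂ) ≠ 0 := by exact_mod_cast hk
    have := ofCont_chi_mem_robinGraph ha n _ _ (-(Complex.I * α))
      (by push_cast; field_simp) (e ▸ continuous_phiFun a α n)
    have e2 : (eig a α n : ℂ) = (k a n : ℂ) ^ 2 := by simp [eig, hn]
    have e3 : phi a α n = ofCont a _ (e ▸ continuous_phiFun a α n) := by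
      simp only [phi, e]
    rw [e2, e3]
    exact this

/-! ### Orthogonality relations -/

theorem integrable_mu_of_continuous {f : ℝ → ℂ} (hf : Continuous f) : Integrable f (mu a) :=
  (memLp_of_continuous a hf).integrable (by norm_num)

theorem integral_mu_const (ha : 0 < a) (c : ℂ) : ∫ _, c ∂(mu a) = 2 * a * c := by
  rw [integral_mu ha, intervalIntegral.integral_const, Complex.real_smul]
  push_cast
  ring

/-- The integrand is, up to the factor `2 k_n`, the derivative of `(χ_n^D)²`, which vanishes at both
ends. -/
theorem integral_chiNFun_mul_chiDFun (ha : 0 < a) {n : ℕ} (hn : n ≠ 0) :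
    ∫ x, chiNFun a n x * chiDFun a n x ∂(mu a) = 0 := by
  have h1 := (HasPrim.of_hasDerivAt (a := a)
    (fun x => (hasDerivAt_chiDFun (a := a) n x).mul (hasDerivAt_chiDFun n x)) (by
      have := continuous_chiNFun a n
      have := continuous_chiDFun a n
      fun_prop)).integral_eq ha
  have e : ∀ x, (k a n : ℂ) * chiNFun a n x * chiDFun a n x
      + chiDFun a n x * (k a n * chiNFun a n x) = (2 * k a n) * (chiNFun a n x * chiDFun a n x) :=
    fun x => by ring
  simp only [e, Pi.mul_apply, chiDFun_right ha, chiDFun_left, integral_const_mul] at h1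
  have hk : (k a n : ℂ) ≠ 0 := by exact_mod_cast (k_pos ha hn).ne'
  simpa [hk] using h1

theorem sqrt_inv_sq (h : 0 < a) : ((1 / √a : ℝ) : ℂ) ^ 2 = 1 / a := by
  rw [← Complex.ofReal_pow, div_pow, Real.sq_sqrt h.le]
  simp

/-- The two integrals are equal, since `(χ_n^N χ_n^D)' = k_n ((χ_n^N)² - (χ_n^D)²)` integrates to
zero, and they add up to `2`, since the squares sum to `1/a`. -/
theorem integral_chiNFun_sq_and_chiDFun_sq (ha : 0 < a) {n : ℕ} (hn : n ≠ 0) :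
    (∫ x, chiNFun a n x * chiNFun a n x ∂(mu a) = 1) ∧
      ∫ x, chiDFun a n x * chiDFun a n x ∂(mu a) = 1 := by
  have c1 := continuous_chiNFun a n
  have c2 := continuous_chiDFun a n
  have h1 := (HasPrim.of_hasDerivAt (a := a)
    (fun x => (hasDerivAt_chiNFun (a := a) n x).mul (hasDerivAt_chiDFun n x)) (by
      fun_prop)).integral_eq ha
  have e : ∀ x, (-(k a n * chiDFun a n x)) * chiDFun a n x
      + chiNFun a n x * (k a n * chiNFun a n x)
        = k a n * (chiNFun a n x * chiNFun a n x - chiDFun a n x * chiDFun a n x) :=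
    fun x => by ring
  have hk : (k a n : ℂ) ≠ 0 := by exact_mod_cast (k_pos ha hn).ne'
  have i1 : Integrable (fun x => chiNFun a n x * chiNFun a n x) (mu a) :=
    integrable_mu_of_continuous (c1.mul c1)
  have i2 : Integrable (fun x => chiDFun a n x * chiDFun a n x) (mu a) :=
    integrable_mu_of_continuous (c2.mul c2)
  simp only [e, Pi.mul_apply, chiDFun_right ha, chiDFun_left, integral_const_mul] at h1
  rw [integral_sub i1 i2] at h1
  simp only [mul_zero, sub_zero, mul_eq_zero, hk, false_or] at h1
  have ha' : (a : ℂ) ≠ 0 := by exact_mod_cast ha.ne'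
  have h2 : ∫ x, chiNFun a n x * chiNFun a n x ∂(mu a)
      + ∫ x, chiDFun a n x * chiDFun a n x ∂(mu a) = 2 := by
    rw [← integral_add i1 i2]
    have e2 : ∀ x, chiNFun a n x * chiNFun a n x + chiDFun a n x * chiDFun a n x = 1 / a := by
      intro x
      rw [← sqrt_inv_sq ha]
      simp only [chiNFun, hn, if_false, chiDFun, ← Complex.ofReal_mul, ← Complex.ofReal_add,
        ← Complex.ofReal_pow]
      congr 1
      linear_combination (1 / √a) ^ 2 * Real.cos_sq_add_sin_sq (k a n * (x + a))
    simp only [e2]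
    rw [integral_mu_const ha]
    field_simp
  constructor
  · linear_combination (h1 + h2) / 2
  · linear_combination (h2 - h1) / 2

theorem inner_chiN_self (ha : 0 < a) (n : ℕ) : inner ℂ (chiN a n) (chiN a n) = (1 : ℂ) := by
  rw [chiN, inner_ofCont]
  simp only [conj_chiNFun]
  by_cases hn : n = 0
  · subst hn
    have ha' : (a : ℂ) ≠ 0 := by exact_mod_cast ha.ne'
    have h2 := sqrt_inv_sq (a := 2 * a) (by linarith)
    simp only [chiNFun, if_true, ← sq, h2]
    rw [integral_mu_const ha]
    push_cast
    field_simp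
  · exact (integral_chiNFun_sq_and_chiDFun_sq ha hn).1

theorem inner_chiN_of_ne (ha : 0 < a) {m n : ℕ} (h : m ≠ n) :
    inner ℂ (chiN a m) (chiN a n) = (0 : ℂ) := by
  have h1 := robinGraph_inner ha (c := 0) (chiN_mem_neumann ha n)
    (by simpa using chiN_mem_neumann ha m)
  rw [inner_smul_left, inner_smul_right, map_pow, Complex.conj_ofReal] at h1
  have h2 : ((k a n : ℂ) ^ 2 - (k a m : ℂ) ^ 2) ≠ 0 := by
    rw [sub_ne_zero]
    norm_cast
    intro h3
    have hn : 0 ≤ k a n := by unfold k; positivity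
    have hm : 0 ≤ k a m := by unfold k; positivity
    exact h (k_injective ha ((pow_left_inj₀ hm hn two_ne_zero).1 h3.symm))
  have h3 : ((k a n : ℂ) ^ 2 - (k a m : ℂ) ^ 2) * inner ℂ (chiN a m) (chiN a n) = 0 := by
    linear_combination h1
  exact (mul_eq_zero.1 h3).resolve_left h2

theorem orthonormal_chiN (ha : 0 < a) : Orthonormal ℂ (chiN a) := by
  rw [orthonormal_iff_ite]
  intro i j
  split_ifs with h
  · rw [h, inner_chiN_self ha]
  · exact inner_chiN_of_ne ha h

/-- The standing assumption: `α` avoids the nonzero points `± k_n`. -/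
def NonResonant (a α : ℝ) : Prop := ∀ n : ℕ, 1 ≤ n → |α| ≠ k a n

theorem NonResonant.sq_ne (ha : 0 < a) (hα : NonResonant a α) {n : ℕ} (hn : n ≠ 0) :
    k a n ^ 2 ≠ α ^ 2 := by
  intro h
  refine hα n (Nat.one_le_iff_ne_zero.2 hn) ?_
  rw [← abs_of_pos (k_pos ha hn)]
  exact (sq_eq_sq_iff_abs_eq_abs _ _).1 h.symm

/-- A zero of the sine means `2αa = nπ`, that is `|α| = k_|n|`, with `n ≠ 0` because `α ≠ 0`. -/
theorem NonResonant.sin_ne_zero (ha : 0 < a) (hα : NonResonant a α) (h0 : α ≠ 0) :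
    Complex.sin (2 * α * a) ≠ 0 := by
  intro h
  have h1 : Real.sin (2 * α * a) = 0 := by exact_mod_cast h
  obtain ⟨n, hn⟩ := Real.sin_eq_zero_iff.1 h1
  have hn0 : n.natAbs ≠ 0 := by
    intro h2
    rw [Int.natAbs_eq_zero] at h2
    subst h2
    have : α * a = 0 := by linear_combination -hn / 2
    rcases mul_eq_zero.1 this with h | h
    · exact h0 h
    · exact ha.ne' h
  refine hα.sq_ne ha hn0 ?_
  have hc : ((n.natAbs : ℕ) : ℝ) ^ 2 = (n : ℝ) ^ 2 := by
    rw [Nat.cast_natAbs]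
    push_cast
    exact sq_abs _
  unfold k
  rw [div_pow, mul_pow, hc, ← mul_pow, hn]
  field_simp

theorem eig_injective (ha : 0 < a) (hα : NonResonant a α) : Function.Injective (eig a α) := by
  intro m n h
  unfold eig at h
  split_ifs at h with hm hn hn
  · rw [hm, hn]
  · exact absurd h.symm (hα.sq_ne ha hn)
  · exact absurd h (hα.sq_ne ha hm)
  · exact k_injective ha ((pow_left_inj₀ (k_pos ha hm).le (k_pos ha hn).le two_ne_zero).1 h)

/-- Eigenvectors of `H` and of the conjugate problem with distinct real eigenvalues are orthogonal;
nonresonance keeps `λ_0 = α²` away from the other eigenvalues. -/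
theorem inner_phi_psi_of_ne (ha : 0 < a) (hα : NonResonant a α) {m n : ℕ} (h : m ≠ n) :
    inner ℂ (phi a α m) (psi a α n) = (0 : ℂ) := by
  have h1 := robinGraph_inner ha (psi_mem_robinGraph ha α n)
    (by
      rw [map_mul, Complex.conj_I, Complex.conj_ofReal, neg_mul]
      exact phi_mem_robinGraph ha α m)
  rw [inner_smul_left, inner_smul_right, Complex.conj_ofReal] at h1
  have h2 : (eig a α n : ℂ) - eig a α m ≠ 0 := by
    rw [sub_ne_zero]
    intro h3
    exact h (eig_injective ha hα (by exact_mod_cast h3.symm))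
  have h3 : ((eig a α n : ℂ) - eig a α m) * inner ℂ (phi a α m) (psi a α n) = 0 := by
    linear_combination h1
  exact (mul_eq_zero.1 h3).resolve_left h2

theorem integral_exp (ha : 0 < a) {s : ℂ} (hs : s ≠ 0) :
    ∫ x : ℝ, Complex.exp (s * (x + a)) ∂(mu a) = (Complex.exp (2 * s * a) - 1) / s := by
  have hd (x : ℝ) : HasDerivAt (fun x : ℝ => Complex.exp (s * (x + a)) / s)
      (Complex.exp (s * (x + a))) x := by
    have h1 : HasDerivAt (fun x : ℝ => s * ((x : ℂ) + a)) (s * 1) x :=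
      (((hasDerivAt_id x).ofReal_comp).add_const (a : ℂ)).const_mul s
    refine (h1.cexp.div_const s).congr_deriv ?_
    field_simp
  rw [(HasPrim.of_hasDerivAt (a := a) hd (by fun_prop)).integral_eq ha, ← sub_div]
  congr 2
  · ring_nf
  · simp

theorem inner_phi_psi_self (ha : 0 < a) (hα : NonResonant a α) (n : ℕ) :
    inner ℂ (phi a α n) (psi a α n) = (1 : ℂ) := by
  rw [phi, psi, inner_ofCont]
  by_cases hn : n = 0
  · subst hn
    have e : ∀ x : ℝ, starRingEnd ℂ (phiFun a α 0 x) * psiFun a α 0 x =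
        (((1 / √(2 * a) : ℝ) : ℂ) * A0 a α) * Complex.exp (-2 * (Complex.I * α) * (x + a)) := by
      intro x
      simp only [phiFun, psiFun, if_true, map_mul, Complex.conj_ofReal, ← Complex.exp_conj,
        map_add, Complex.conj_I]
      have : Complex.exp (-2 * (Complex.I * α) * (x + a)) =
          Complex.exp (-Complex.I * α * (x + a)) * Complex.exp (-(Complex.I * α * (x + a))) := by
        rw [← Complex.exp_add]
        ring_nf
      rw [this]
      ring
    simp only [e]
    rw [integral_const_mul]
    have ha' : (a : ℂ) ≠ 0 := by exact_mod_cast ha.ne'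
    have h2 := sqrt_inv_sq (a := 2 * a) (by linarith)
    by_cases h0 : α = 0
    · subst h0
      simp only [A0, if_true, Complex.ofReal_zero, mul_zero, zero_mul, Complex.exp_zero]
      rw [integral_mu_const ha, ← sq, h2]
      push_cast
      field_simp
    · have hs := hα.sin_ne_zero ha h0
      have h0' : (α : ℂ) ≠ 0 := by exact_mod_cast h0
      have hI := Complex.I_ne_zero
      rw [integral_exp ha (by simp [h0'])]
      simp only [A0, h0, if_false]
      have hq : ((1 / √(2 * a) : ℝ) : ℂ) * ((√(2 * a) : ℝ) : ℂ) = 1 := by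
        rw [← Complex.ofReal_mul, one_div_mul_cancel (Real.sqrt_ne_zero'.2 (by linarith))]
        simp
      have hsin : Complex.sin (2 * α * a) = (Complex.exp (-(2 * α * a * Complex.I))
          - Complex.exp (2 * α * a * Complex.I)) * Complex.I / 2 := by
        rw [Complex.sin, neg_mul]
      have h3 : Complex.exp (2 * (-2 * (Complex.I * α)) * a)
          = Complex.exp (-(2 * α * a * Complex.I)) * Complex.exp (-(2 * α * a * Complex.I)) := by
        rw [← Complex.exp_add]
        ring_nf
      have h4 : Complex.exp (2 * Complex.I * α * a) = Complex.exp (2 * α * a * Complex.I) := by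
        ring_nf
      have h5 : Complex.exp (2 * α * a * Complex.I) * Complex.exp (-(2 * α * a * Complex.I)) = 1 := by
        rw [← Complex.exp_add]
        simp
      rw [h3, h4]
      rw [hsin] at hs ⊢
      set E := Complex.exp (2 * α * a * Complex.I)
      set F := Complex.exp (-(2 * α * a * Complex.I))
      have hFE : F - E ≠ 0 := fun h => hs (by rw [h]; simp)
      -- Here `E` and `F` are `e^{2iαa}` and `e^{-2iαa}`. Since `EF = 1`, the numerator `EFF - E`
      -- equals `F - E`, and the constant `A_0` normalizes the product to `1`.
      have e6 : ∀ q r : ℂ, q * (α * E * r / ((F - E) * Complex.I / 2)) *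
          ((F * F - 1) / (-2 * (Complex.I * α))) = q * r * ((E * F * F - E) / (F - E)) := by
        intro q r
        field_simp
        rw [Complex.I_sq]
        ring
      rw [e6, hq, h5, one_mul, one_mul, div_self hFE]
  · set r : ℂ := (((k a n) ^ 2 / ((k a n) ^ 2 - α ^ 2) : ℝ) : ℂ) with hr
    set s : ℂ := Complex.I * ((α / k a n : ℝ) : ℂ) with hs
    have hsc : starRingEnd ℂ s = -s := by
      rw [hs, map_mul, Complex.conj_I, Complex.conj_ofReal, neg_mul]
    have e : ∀ x : ℝ, starRingEnd ℂ (phiFun a α n x) * psiFun a α n x =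
        r * (chiNFun a n x * chiNFun a n x + (-2 * s) * (chiNFun a n x * chiDFun a n x)
          + s ^ 2 * (chiDFun a n x * chiDFun a n x)) := by
      intro x
      simp only [phiFun, psiFun, hn, if_false, map_mul, map_add, conj_chiNFun, conj_chiDFun,
        ← hr, ← hs, hsc]
      ring
    have c1 := continuous_chiNFun a n
    have c2 := continuous_chiDFun a n
    have i1 : Integrable (fun x => chiNFun a n x * chiNFun a n x) (mu a) :=
      integrable_mu_of_continuous (c1.mul c1)
    have i2 : Integrable (fun x => chiDFun a n x * chiDFun a n x) (mu a) :=
      integrable_mu_of_continuous (c2.mul c2)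
    have i3 : Integrable (fun x => chiNFun a n x * chiDFun a n x) (mu a) :=
      integrable_mu_of_continuous (c1.mul c2)
    have i4 : Integrable (fun x => chiNFun a n x * chiNFun a n x
        + (-2 * s) * (chiNFun a n x * chiDFun a n x)) (mu a) := i1.add (i3.const_mul (-2 * s))
    simp only [e]
    rw [integral_const_mul, integral_add i4 (i2.const_mul _), integral_add i1 (i3.const_mul _),
      integral_const_mul, integral_const_mul, integral_chiNFun_mul_chiDFun ha hn,
      (integral_chiNFun_sq_and_chiDFun_sq ha hn).1, (integral_chiNFun_sq_and_chiDFun_sq ha hn).2, hr, hs, mul_pow,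
      Complex.I_sq]
    have h1 := (k_pos ha hn).ne'
    have h2 : k a n ^ 2 - α ^ 2 ≠ 0 := sub_ne_zero.2 (hα.sq_ne ha hn)
    -- The factor in `ψ_n` is chosen so that this product is `1`; the cross term has integral zero.
    have : (k a n ^ 2 / (k a n ^ 2 - α ^ 2)) * (1 - (α / k a n) ^ 2) = 1 := by
      field_simp
    have := congrArg (fun x : ℝ => (x : ℂ)) this
    push_cast at this ⊢
    linear_combination this

theorem inner_phi_psi (ha : 0 < a) (hα : NonResonant a α) (m n : ℕ) :
    inner ℂ (phi a α m) (psi a α n) = if m = n then (1 : ℂ) else 0 := by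
  split_ifs with h
  · rw [h, inner_phi_psi_self ha hα]
  · exact inner_phi_psi_of_ne ha hα h

/-! ### Completeness of the cosines -/

/-- With `s = k_1 (x + a)`, which runs over `[0, π]`, the cosines `cos(ns)` generate all polynomials
in `cos s`. As `cos` is injective on `[0, π]`, every test function is a continuous function of `cos
s`, and Weierstrass approximation shows that `f` integrates to zero against it. -/
theorem eq_zero_of_inner_chiN_eq_zero (ha : 0 < a) {f : L2 a}
    (hf : ∀ n, inner ℂ (chiN a n) f = (0 : ℂ)) : f = 0 := by
  set s : ℝ → ℝ := fun x => k a 1 * (x + a) with hs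
  have hsc : Continuous s := by fun_prop
  have hfi : Integrable f (mu a) := (Lp.memLp f).integrable (by norm_num)
  have hcos : ∀ n : ℕ, ∫ x, ((Real.cos (n * s x) : ℝ) : ℂ) * f x ∂(mu a) = 0 := by
    intro n
    have h1 := hf n
    rw [chiN, inner_ofCont_left] at h1
    simp only [conj_chiNFun] at h1
    by_cases hn : n = 0
    · subst hn
      have h2 : √(2 * a) ≠ 0 := Real.sqrt_ne_zero'.2 (by linarith)
      simp only [chiNFun, if_true, integral_const_mul, mul_eq_zero] at h1
      rcases h1 with h1 | h1
      · exact absurd (Complex.ofReal_eq_zero.1 h1) (one_div_ne_zero h2)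
      · simpa using h1
    · have h2 : √a ≠ 0 := Real.sqrt_ne_zero'.2 ha
      have e : ∀ x, chiNFun a n x * f x
          = ((1 / √a : ℝ) : ℂ) * (((Real.cos (n * s x) : ℝ) : ℂ) * f x) := by
        intro x
        have : k a n * (x + a) = n * s x := by
          simp only [hs, k]
          push_cast
          ring
        simp only [chiNFun, hn, if_false, this]
        push_cast
        ring
      simp only [e, integral_const_mul, mul_eq_zero] at h1
      rcases h1 with h1 | h1
      · exact absurd (Complex.ofReal_eq_zero.1 h1) (one_div_ne_zero h2)
      · exact h1
  have hint : ∀ g : ℝ → ℝ, Continuous g → Integrable (fun x => ((g x : ℝ) : ℂ) * f x) (mu a) := by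
    intro g hg
    obtain ⟨C, hC⟩ := (isCompact_Icc (a := -a) (b := a)).exists_bound_of_continuousOn hg.continuousOn
    refine hfi.bdd_mul (c := C) (Complex.continuous_ofReal.comp hg).aestronglyMeasurable ?_
    filter_upwards [ae_mu_mem a] with x hx
    simpa using hC x hx
  -- The extra factor `cos(ms)` makes the induction on `j` close: the product formula replaces one
  -- factor `cos s` by a shift of `m` in both directions. Only `m = 0` is used afterwards.
  have hpow : ∀ j m : ℕ,
      ∫ x, ((Real.cos (s x) ^ j * Real.cos (m * s x) : ℝ) : ℂ) * f x ∂(mu a) = 0 := by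
    intro j
    induction j with
    | zero => intro m; simpa using hcos m
    | succ j ih =>
      intro m
      cases m with
      | zero =>
        have := ih 1
        simpa [pow_succ] using this
      | succ m =>
        have e : ∀ x, ((Real.cos (s x) ^ (j + 1) * Real.cos ((m + 1 : ℕ) * s x) : ℝ) : ℂ) * f x
            = (1 / 2 : ℂ) * (((Real.cos (s x) ^ j * Real.cos ((m + 2 : ℕ) * s x) : ℝ) : ℂ) * f x
              + ((Real.cos (s x) ^ j * Real.cos (m * s x) : ℝ) : ℂ) * f x) := by
          intro x
          have h : Real.cos (s x) * Real.cos ((m + 1 : ℕ) * s x)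
              = 1 / 2 * (Real.cos ((m + 2 : ℕ) * s x) + Real.cos (m * s x)) := by
            have h1 : ((m + 2 : ℕ) : ℝ) * s x = (m + 1 : ℕ) * s x + s x := by push_cast; ring
            have h2 : (m : ℝ) * s x = (m + 1 : ℕ) * s x - s x := by push_cast; ring
            rw [h1, h2, Real.cos_add, Real.cos_sub]
            ring
          have h' : Real.cos (s x) ^ (j + 1) * Real.cos ((m + 1 : ℕ) * s x)
              = Real.cos (s x) ^ j * (1 / 2 * (Real.cos ((m + 2 : ℕ) * s x) + Real.cos (m * s x))) := by
            rw [← h]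
            ring
          rw [h']
          push_cast
          ring
        simp only [e]
        rw [integral_const_mul, integral_add (hint _ (by fun_prop)) (hint _ (by fun_prop)),
          ih, ih]
        simp
  have hintp : ∀ p : Polynomial ℝ,
      Integrable (fun x => ((p.eval (Real.cos (s x)) : ℝ) : ℂ) * f x) (mu a) := fun p =>
    hint _ (p.continuous.comp (Real.continuous_cos.comp hsc))
  have hpoly : ∀ p : Polynomial ℝ,
      ∫ x, ((p.eval (Real.cos (s x)) : ℝ) : ℂ) * f x ∂(mu a) = 0 := by
    intro p
    induction p using Polynomial.induction_on' with
    | add p q hp hq =>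
      simp only [Polynomial.eval_add, Complex.ofReal_add, add_mul]
      rw [integral_add (hintp p) (hintp q), hp, hq, add_zero]
    | monomial n c =>
      have := hpow n 0
      simp only [Nat.cast_zero, zero_mul, Real.cos_zero, mul_one] at this
      simp only [Polynomial.eval_monomial, Complex.ofReal_mul, mul_assoc]
      rw [integral_const_mul, this, mul_zero]
  refine ae_eq_zero_of_forall_isTest fun θ hθ => ?_
  have hk1 : k a 1 ≠ 0 := (k_pos ha one_ne_zero).ne'
  have hsx : ∀ x ∈ Icc (-a) a, Real.arccos (Real.cos (s x)) / k a 1 - a = x := by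
    intro x hx
    have h0 : 0 < k a 1 := k_pos ha one_ne_zero
    have hpi : k a 1 * (a + a) = Real.pi := by simpa using k_mul_two ha 1
    rw [Real.arccos_cos]
    · simp only [hs]
      field_simp
      ring
    · exact mul_nonneg h0.le (by linarith [hx.1])
    · rw [← hpi]
      exact mul_le_mul_of_nonneg_left (by linarith [hx.2]) h0.le
  -- This is `θ` as a function of `y = cos s`; the inverse substitution is `x = arccos y / k_1 - a`.
  have hgc : Continuous fun y => θ (Real.arccos y / k a 1 - a) :=
    hθ.1.continuous.comp (by fun_prop)
  set N := ∫ x, ‖f x‖ ∂(mu a) with hN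
  have hbound : ∀ ε > 0, ‖∫ x, ((θ x : ℝ) : ℂ) * f x ∂(mu a)‖ ≤ ε * N := by
    intro ε hε
    obtain ⟨p, hp⟩ := exists_polynomial_near_of_continuousOn (-1) 1 _ hgc.continuousOn ε hε
    have e : ∫ x, ((θ x : ℝ) : ℂ) * f x ∂(mu a)
        = ∫ x, ((θ x - p.eval (Real.cos (s x)) : ℝ) : ℂ) * f x ∂(mu a) := by
      simp only [Complex.ofReal_sub, sub_mul]
      rw [integral_sub (hθ.integrable f) (hintp p), hpoly, sub_zero]
    rw [e, hN, ← integral_const_mul]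
    refine norm_integral_le_of_norm_le (hfi.norm.const_mul ε) ?_
    filter_upwards [ae_mu_mem a] with x hx
    rw [norm_mul]
    refine mul_le_mul_of_nonneg_right ?_ (norm_nonneg _)
    have := hp (Real.cos (s x)) ⟨Real.neg_one_le_cos _, Real.cos_le_one _⟩
    rw [hsx x hx, abs_sub_comm] at this
    rw [Complex.norm_real]
    exact this.le
  have hN0 : 0 ≤ N := integral_nonneg fun x => norm_nonneg _
  have hle : ‖∫ x, ((θ x : ℝ) : ℂ) * f x ∂(mu a)‖ ≤ 0 := by
    refine le_of_forall_pos_le_add fun ε hε => ?_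
    -- The shift `N + 1` guards against `N = 0`.
    have h1 := hbound (ε / (N + 1)) (by positivity)
    have h2 : ε / (N + 1) * N ≤ ε := by
      rw [div_mul_eq_mul_div, div_le_iff₀ (by positivity)]
      nlinarith
    linarith
  exact norm_le_zero_iff.1 hle

/-- The Neumann eigenfunctions form a Hilbert basis of `L²(-a, a)`. -/
def chiNBasis (ha : 0 < a) : HilbertBasis ℕ ℂ (L2 a) :=
  HilbertBasis.mkOfOrthogonalEqBot (orthonormal_chiN ha) (by
    rw [Submodule.eq_bot_iff]
    intro f hf
    refine eq_zero_of_inner_chiN_eq_zero ha fun n => ?_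
    exact (Submodule.mem_orthogonal _ _).1 hf _ (Submodule.subset_span ⟨n, rfl⟩))

theorem coe_chiNBasis (ha : 0 < a) : ⇑(chiNBasis ha) = chiN a :=
  HilbertBasis.coe_mkOfOrthogonalEqBot _ _

theorem hasSum_chiN (ha : 0 < a) (f : L2 a) :
    HasSum (fun n => inner ℂ (chiN a n) f • chiN a n) f := by
  have := (chiNBasis ha).hasSum_repr f
  simpa only [HilbertBasis.repr_apply_apply, coe_chiNBasis] using this

theorem eq_of_inner_chiN (ha : 0 < a) {f g : L2 a}
    (h : ∀ n, inner ℂ (chiN a n) f = (inner ℂ (chiN a n) g : ℂ)) : f = g :=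
  sub_eq_zero.1 (eq_zero_of_inner_chiN_eq_zero ha fun n => by rw [inner_sub_right, h, sub_self])

theorem dense_of_chiN_mem (ha : 0 < a) (S : Submodule ℂ (L2 a)) (h : ∀ n, chiN a n ∈ S) :
    Dense (S : Set (L2 a)) := by
  have h1 := (chiNBasis ha).dense_span
  rw [coe_chiNBasis] at h1
  have h2 : Submodule.span ℂ (range (chiN a)) ≤ S :=
    Submodule.span_le.2 (range_subset_iff.2 h)
  have h3 := Submodule.topologicalClosure_mono h2
  rw [h1, top_le_iff] at h3
  exact Submodule.dense_iff_topologicalClosure_eq_top.2 h3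

/-! ### Operators with bounded kernels -/

/-- On a finite measure space the `L¹` norm is controlled by the `L²` norm, by Hölder's inequality.
-/
theorem exists_integral_norm_le (a : ℝ) :
    ∃ B : ℝ, 0 ≤ B ∧ ∀ f : L2 a, ∫ x, ‖f x‖ ∂(mu a) ≤ B * ‖f‖ := by
  refine ⟨((mu a) univ ^ ((1 : ℝ) / (1 : ENNReal).toReal - 1 / (2 : ENNReal).toReal)).toReal,
    ENNReal.toReal_nonneg, fun f => ?_⟩
  have h := eLpNorm_le_eLpNorm_mul_rpow_measure_univ (μ := mu a) (p := 1) (q := 2)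
    (f := f) (by norm_num) (Lp.aestronglyMeasurable f)
  rw [integral_norm_eq_lintegral_enorm (Lp.aestronglyMeasurable f), ← eLpNorm_one_eq_lintegral_enorm,
    Lp.norm_def, mul_comm, ← ENNReal.toReal_mul]
  refine ENNReal.toReal_mono (ENNReal.mul_ne_top (Lp.eLpNorm_ne_top f) ?_) h
  exact ENNReal.rpow_ne_top_of_nonneg (by norm_num) (measure_ne_top _ _)

/-- A bounded measurable kernel is square integrable because the measure is finite, and it maps `L²`
to bounded functions. -/
theorem exists_isIntegralOperator {K : ℝ → ℝ → ℂ} (hK : Measurable (Function.uncurry K)) {C : ℝ}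
    (hC : ∀ x ∈ Icc (-a) a, ∀ y ∈ Icc (-a) a, ‖K x y‖ ≤ C) :
    ∃ T : L2 a →L[ℂ] L2 a, IsIntegralOperator a T K := by
  have hC' : ∀ x ∈ Icc (-a) a, ∀ y ∈ Icc (-a) a, ‖K x y‖ ≤ |C| := fun x hx y hy =>
    (hC x hx y hy).trans (le_abs_self C)
  obtain ⟨B, hB, hBf⟩ := exists_integral_norm_le a
  have hint (f : L2 a) : Integrable f (mu a) := (Lp.memLp f).integrable (by norm_num)
  have hKi (f : L2 a) (x : ℝ) (hx : x ∈ Icc (-a) a) :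
      Integrable (fun y => K x y * f y) (mu a) := by
    refine (hint f).bdd_mul (c := |C|)
      (hK.comp measurable_prodMk_left).aestronglyMeasurable ?_
    filter_upwards [ae_mu_mem a] with y hy using hC' x hx y hy
  have hm (f : L2 a) : AEStronglyMeasurable (fun x => ∫ y, K x y * f y ∂(mu a)) (mu a) := by
    have h1 : AEStronglyMeasurable (fun p : ℝ × ℝ => K p.1 p.2 * f p.2) ((mu a).prod (mu a)) :=
      hK.aestronglyMeasurable.mul (Lp.aestronglyMeasurable f).comp_snd
    exact h1.integral_prod_right'
  have hb (f : L2 a) : ∀ᵐ x ∂(mu a), ‖∫ y, K x y * f y ∂(mu a)‖ ≤ |C| * (B * ‖f‖) := by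
    filter_upwards [ae_mu_mem a] with x hx
    refine (norm_integral_le_of_norm_le ((hint f).norm.const_mul |C|) ?_).trans ?_
    · filter_upwards [ae_mu_mem a] with y hy
      rw [norm_mul]
      exact mul_le_mul_of_nonneg_right (hC' x hx y hy) (norm_nonneg _)
    · rw [integral_const_mul]
      exact mul_le_mul_of_nonneg_left (hBf f) (abs_nonneg _)
  have hL (f : L2 a) : MemLp (fun x => ∫ y, K x y * f y ∂(mu a)) 2 (mu a) :=
    MemLp.of_bound (hm f) _ (hb f)
  let T : L2 a →ₗ[ℂ] L2 a :=
    { toFun := fun f => (hL f).toLp _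
      map_add' := fun f g => by
        refine Lp.ext ?_
        filter_upwards [(hL (f + g)).coeFn_toLp, Lp.coeFn_add ((hL f).toLp _) ((hL g).toLp _),
          (hL f).coeFn_toLp, (hL g).coeFn_toLp, ae_mu_mem a] with x h1 h2 h3 h4 hx
        rw [h1, h2, Pi.add_apply, h3, h4, ← integral_add (hKi f x hx) (hKi g x hx)]
        refine integral_congr_ae ?_
        filter_upwards [Lp.coeFn_add f g] with y hy
        rw [hy, Pi.add_apply, mul_add]
      map_smul' := fun c f => by
        refine Lp.ext ?_
        filter_upwards [(hL (c • f)).coeFn_toLp, Lp.coeFn_smul c ((hL f).toLp _),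
          (hL f).coeFn_toLp] with x h1 h2 h3
        rw [RingHom.id_apply, h1, h2, Pi.smul_apply, h3, smul_eq_mul, ← integral_const_mul]
        refine integral_congr_ae ?_
        filter_upwards [Lp.coeFn_smul c f] with y hy
        rw [hy, Pi.smul_apply, smul_eq_mul]
        ring }
  refine ⟨T.mkContinuous ((measureUnivNNReal (mu a) : ℝ) ^ ((2 : ENNReal).toReal)⁻¹ * (|C| * B))
    fun f => ?_, ?_, fun f => (hL f).coeFn_toLp⟩
  · have h1 := Lp.norm_le_of_ae_bound (f := T f) (C := |C| * (B * ‖f‖)) (by positivity) (by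
      filter_upwards [(hL f).coeFn_toLp, hb f] with x h1 h2
      change ‖(hL f).toLp _ x‖ ≤ _
      rw [h1]
      exact h2)
    refine h1.trans (le_of_eq ?_)
    ring
  · refine MemLp.of_bound hK.aestronglyMeasurable C ?_
    have h1 : ∀ᵐ p ∂((mu a).prod (mu a)), p.1 ∈ Icc (-a) a :=
      Measure.quasiMeasurePreserving_fst.ae (ae_mu_mem a)
    have h2 : ∀ᵐ p ∂((mu a).prod (mu a)), p.2 ∈ Icc (-a) a :=
      Measure.quasiMeasurePreserving_snd.ae (ae_mu_mem a)
    filter_upwards [h1, h2] with p hp1 hp2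
    exact hC _ hp1 _ hp2

theorem measurable_sign : Measurable Real.sign := by
  unfold Real.sign
  exact Measurable.ite measurableSet_Iio measurable_const
    (Measurable.ite measurableSet_Ioi measurable_const measurable_const)

theorem abs_sign_le (x : ℝ) : |Real.sign x| ≤ 1 := by
  rcases Real.sign_apply_eq x with h | h | h <;> rw [h] <;> simp

theorem integral_sign_mul (ha : 0 < a) {g : ℝ → ℂ} (hg : IntervalIntegrable g volume (-a) a)
    {x : ℝ} (hx : x ∈ Icc (-a) a) :
    ∫ y, ((Real.sign (y - x) : ℝ) : ℂ) * g y ∂(mu a)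
      = (∫ y in (-a)..a, g y) - 2 * ∫ y in (-a)..x, g y := by
  -- `Real.sign` is `0` at `0`, so the identity on the left half fails at `y = x` and holds only
  -- almost everywhere.
  have hne : ∀ᵐ y : ℝ, y ≠ x := by simp [ae_iff, measure_singleton]
  have hl := intervalIntegrable_to hg hx
  have hr : IntervalIntegrable g volume x a := hl.symm.trans hg
  have e1 : ∀ᵐ y : ℝ, y ∈ uIoc (-a) x → -g y = ((Real.sign (y - x) : ℝ) : ℂ) * g y := by
    filter_upwards [hne] with y hy hm
    rw [uIoc_of_le hx.1] at hm
    rw [Real.sign_of_neg (sub_neg.2 (lt_of_le_of_ne hm.2 hy))]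
    simp
  have e2 : ∀ᵐ y : ℝ, y ∈ uIoc x a → g y = ((Real.sign (y - x) : ℝ) : ℂ) * g y := by
    refine Eventually.of_forall fun y hm => ?_
    rw [uIoc_of_le hx.2] at hm
    rw [Real.sign_of_pos (sub_pos.2 hm.1)]
    simp
  rw [integral_mu ha, ← intervalIntegral.integral_add_adjacent_intervals
    (hl.neg.congr_ae ((ae_restrict_iff' measurableSet_uIoc).2 e1))
    (hr.congr_ae ((ae_restrict_iff' measurableSet_uIoc).2 e2)),
    ← intervalIntegral.integral_congr_ae e1, ← intervalIntegral.integral_congr_ae e2,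
    ← intervalIntegral.integral_add_adjacent_intervals hl hr, intervalIntegral.integral_neg]
  ring

theorem integrable_mul_coe {p : ℝ → ℂ} (hp : Continuous p) (f : L2 a) :
    Integrable (fun y => p y * f y) (mu a) := by
  obtain ⟨C, hC⟩ := (isCompact_Icc (a := -a) (b := a)).exists_bound_of_continuousOn hp.continuousOn
  refine ((Lp.memLp f).integrable (by norm_num)).bdd_mul (c := C) hp.aestronglyMeasurable ?_
  filter_upwards [ae_mu_mem a] with x hx using hC x hx

theorem integrable_sign_mul {g : ℝ → ℂ} (hg : Integrable g (mu a)) (x : ℝ) :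
    Integrable (fun y => ((Real.sign (y - x) : ℝ) : ℂ) * g y) (mu a) := by
  refine hg.bdd_mul (c := 1) ?_ (Eventually.of_forall fun y => ?_)
  · exact (Complex.measurable_ofReal.comp
      (measurable_sign.comp (measurable_id.sub_const x))).aestronglyMeasurable
  · rw [Complex.norm_real]
    exact abs_sign_le _

theorem inner_chiN_zero (f : L2 a) :
    inner ℂ (chiN a 0) f = ((1 / √(2 * a) : ℝ) : ℂ) * ∫ x, f x ∂(mu a) := by
  rw [chiN, inner_ofCont_left, ← integral_const_mul]
  simp only [chiNFun, if_true, Complex.conj_ofReal]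

theorem inner_phi_zero (f : L2 a) :
    inner ℂ (phi a α 0) f = ((1 / √(2 * a) : ℝ) : ℂ) *
      ∫ x, Complex.exp (-(Complex.I * α * (x + a))) * f x ∂(mu a) := by
  rw [phi, inner_ofCont_left, ← integral_const_mul]
  refine integral_congr_ae (Eventually.of_forall fun x => ?_)
  simp only [phiFun, if_true, map_mul, Complex.conj_ofReal, ← Complex.exp_conj, map_add,
    Complex.conj_I, neg_mul]
  ring

theorem coe_add_ae (f g : L2 a) : (f + g : L2 a) =ᵐ[mu a] fun x => f x + g x :=
  Lp.coeFn_add f g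

theorem coe_smul_ae (c : ℂ) (f : L2 a) : (c • f : L2 a) =ᵐ[mu a] fun x => c * f x :=
  Lp.coeFn_smul c f

/-! ### The operator with kernel `𝓛` -/

theorem measurable_kernelL (a α : ℝ) : Measurable (Function.uncurry (kernelL a α)) := by
  have h : Measurable fun p : ℝ × ℝ => ((Real.sign (p.2 - p.1) : ℝ) : ℂ) :=
    Complex.measurable_ofReal.comp (measurable_sign.comp (measurable_snd.sub measurable_fst))
  unfold Function.uncurry kernelL
  fun_prop

theorem exists_bound_kernelL (ha : 0 < a) (α : ℝ) :
    ∃ C, ∀ x ∈ Icc (-a) a, ∀ y ∈ Icc (-a) a, ‖kernelL a α x y‖ ≤ C := by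
  have h1 : Continuous fun y : ℝ => Complex.I * α / (2 * a) * y
      + 1 / (2 * a) * (Complex.exp (-(Complex.I * α * (y + a))) - 1) := by fun_prop
  obtain ⟨C, hC⟩ := (isCompact_Icc (a := -a) (b := a)).exists_bound_of_continuousOn h1.continuousOn
  refine ⟨C + ‖Complex.I * α / 2‖, fun x _ y hy => ?_⟩
  have ha' : (a : ℂ) ≠ 0 := by exact_mod_cast ha.ne'
  have e : kernelL a α x y = (Complex.I * α / (2 * a) * y
      + 1 / (2 * a) * (Complex.exp (-(Complex.I * α * (y + a))) - 1))
      - Complex.I * α / 2 * Real.sign (y - x) := by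
    unfold kernelL
    field_simp
    ring
  rw [e]
  refine (norm_sub_le _ _).trans (add_le_add (hC y hy) ?_)
  rw [norm_mul, Complex.norm_real]
  exact mul_le_of_le_one_right (norm_nonneg _) (abs_sign_le _)

/-- The sign term turns the integral into a primitive in `x`: a constant plus `iα` times the
integral of `f` from `-a` to `x`. -/
theorem integral_kernelL_mul (ha : 0 < a) (α : ℝ) (f : L2 a) {x : ℝ} (hx : x ∈ Icc (-a) a) :
    ∫ y, kernelL a α x y * f y ∂(mu a) =
      ((∫ y, (Complex.I * α / (2 * a) * (y - a)
        + 1 / (2 * a) * (Complex.exp (-(Complex.I * α * (y + a))) - 1)) * f y ∂(mu a))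
        + ∫ y in (-a)..x, Complex.I * α * f y) := by
  have ha' : (a : ℂ) ≠ 0 := by exact_mod_cast ha.ne'
  have hfi : Integrable f (mu a) := (Lp.memLp f).integrable (by norm_num)
  have e : ∀ y : ℝ, kernelL a α x y * f y = (Complex.I * α / (2 * a) * (y - a)
      + 1 / (2 * a) * (Complex.exp (-(Complex.I * α * (y + a))) - 1)) * f y
      + ((Complex.I * α / 2) * f y
        - (Complex.I * α / 2) * (((Real.sign (y - x) : ℝ) : ℂ) * f y)) := by
    intro y
    unfold kernelL
    field_simp
    ring
  have i1 : Integrable (fun y => (Complex.I * α / 2) * f y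
      - (Complex.I * α / 2) * (((Real.sign (y - x) : ℝ) : ℂ) * f y)) (mu a) :=
    (hfi.const_mul _).sub ((integrable_sign_mul hfi x).const_mul _)
  have i2 : Integrable (fun y : ℝ => (Complex.I * α / (2 * a) * (y - a)
      + 1 / (2 * a) * (Complex.exp (-(Complex.I * α * (y + a))) - 1)) * f y) (mu a) :=
    integrable_mul_coe (by fun_prop) f
  simp only [e]
  rw [integral_add i2 i1, integral_sub (hfi.const_mul _) ((integrable_sign_mul hfi x).const_mul _),
    integral_const_mul, integral_const_mul, integral_sign_mul ha (intervalIntegrable_coe ha f) hx,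
    intervalIntegral.integral_const_mul, integral_mu ha f]
  ring

/-- These are the two properties that determine `Ω - I`: a first-order equation and the value of one
functional. -/
theorem exists_operator_kernelL (ha : 0 < a) (α : ℝ) : ∃ T : L2 a →L[ℂ] L2 a,
    IsIntegralOperator a T (kernelL a α) ∧
    (∀ f, IsWeakDeriv a (T f) ((Complex.I * α) • f)) ∧
    ∀ f, inner ℂ (chiN a 0) (f + T f) = (inner ℂ (phi a α 0) f : ℂ) := by
  obtain ⟨C, hC⟩ := exists_bound_kernelL ha α
  obtain ⟨T, hT⟩ := exists_isIntegralOperator (measurable_kernelL a α) hC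
  have hprim (f : L2 a) (c : ℂ) : HasPrim a (fun x => c + ∫ y in (-a)..x, Complex.I * α * f y)
      (fun y => Complex.I * α * f y) :=
    HasPrim.primitive ((intervalIntegrable_coe ha f).const_mul _) c
  have hTf (f : L2 a) := (hT.2 f).trans (show _ =ᵐ[mu a] _ by
    filter_upwards [ae_mu_mem a] with x hx
    exact integral_kernelL_mul ha α f hx)
  refine ⟨T, hT, fun f => ?_, fun f => ?_⟩
  · exact ((hprim f _).congr_right ha (coe_smul_ae _ f).symm).isWeakDeriv ha (hTf f)
  · have hfi : Integrable f (mu a) := (Lp.memLp f).integrable (by norm_num)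
    have hTi : Integrable (T f) (mu a) := (Lp.memLp (T f)).integrable (by norm_num)
    rw [inner_chiN_zero, inner_phi_zero]
    congr 1
    rw [integral_congr_ae (coe_add_ae f (T f)), integral_add hfi hTi]
    set c := ∫ y, (Complex.I * α / (2 * a) * (y - a)
        + 1 / (2 * a) * (Complex.exp (-(Complex.I * α * (y + a))) - 1)) * f y ∂(mu a) with hc
    -- The weight `x - a` vanishes at `a` and equals `-2a` at `-a`, so integration by parts
    -- expresses the integral of `T f` through its value `c` at `-a`.
    have hx : HasPrim a (fun x : ℝ => (x : ℂ) - a) (fun _ => 1) :=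
      HasPrim.of_hasDerivAt (fun x => by
        simpa using ((hasDerivAt_id x).ofReal_comp).sub_const (a : ℂ)) continuous_const
    have h1 := (hx.mul ha (hprim f c)).integral_eq ha
    have i1 : Integrable (fun x : ℝ => 1 * (c + ∫ y in (-a)..x, Complex.I * α * f y)) (mu a) :=
      hTi.congr (by
        filter_upwards [hTf f] with x h
        rw [h, one_mul])
    have i2 : Integrable (fun x : ℝ => ((x : ℂ) - a) * (Complex.I * α * f x)) (mu a) := by
      refine (integrable_mul_coe (p := fun x : ℝ => ((x : ℂ) - a) * (Complex.I * α))
        (by fun_prop) f).congr (Eventually.of_forall fun x => ?_)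
      simp only [mul_assoc]
    rw [integral_add i1 i2] at h1
    simp only [one_mul, sub_self, zero_mul, intervalIntegral.integral_same, add_zero] at h1
    rw [integral_congr_ae (hTf f)]
    have ha' : (a : ℂ) ≠ 0 := by exact_mod_cast ha.ne'
    have i3 : Integrable (fun x : ℝ => Complex.exp (-(Complex.I * α * (x + a))) * f x) (mu a) :=
      integrable_mul_coe (by fun_prop) f
    have i4 : Integrable (fun x : ℝ => Complex.exp (-(Complex.I * α * (x + a))) * f x - f x)
        (mu a) := i3.sub hfi
    have h2 : 2 * a * c = ∫ x, ((x : ℂ) - a) * (Complex.I * α * f x) ∂(mu a)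
        + ((∫ x : ℝ, Complex.exp (-(Complex.I * α * (x + a))) * f x ∂(mu a)) - ∫ x, f x ∂(mu a)) := by
      rw [← integral_sub i3 hfi, ← integral_add i2 i4, hc, ← integral_const_mul]
      refine integral_congr_ae (Eventually.of_forall fun x => ?_)
      field_simp
    push_cast at h1
    linear_combination h1 + h2

/-! ### The operator with kernel `𝓜` -/

/-- The part of the kernel `𝓜` which depends on `y` only, up to the factor `e^{-iαx}`. -/
def kernelMAux (a α y : ℝ) : ℂ :=
  α * Complex.exp (Complex.I * α * a) / Complex.sin (2 * α * a)
    - α / 2 * Complex.cot (2 * α * a) * Complex.exp (Complex.I * α * y)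
    - α * Complex.exp (-(Complex.I * α * y)) / (2 * Complex.sin (2 * α * a))

theorem continuous_kernelMAux (a α : ℝ) : Continuous (kernelMAux a α) := by
  unfold kernelMAux
  fun_prop

/-- After factoring out `e^{-iαx}`, the kernel depends on `x` only through the sign, so that the
integral again becomes a primitive in `x`. -/
theorem kernelM_eq (h0 : α ≠ 0) (x y : ℝ) :
    kernelM a α x y = Complex.exp (-(Complex.I * α * x)) * (kernelMAux a α y
      + Complex.I * α / 2 * (Real.sign (y - x) * Complex.exp (Complex.I * α * y))) := by
  have e1 : Complex.exp (Complex.I * α * (a - x))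
      = Complex.exp (-(Complex.I * α * x)) * Complex.exp (Complex.I * α * a) := by
    rw [← Complex.exp_add]
    ring_nf
  have e2 : Complex.exp (-(Complex.I * α * (x - y)))
      = Complex.exp (-(Complex.I * α * x)) * Complex.exp (Complex.I * α * y) := by
    rw [← Complex.exp_add]
    ring_nf
  have e3 : Complex.exp (-(Complex.I * α * (x + y)))
      = Complex.exp (-(Complex.I * α * x)) * Complex.exp (-(Complex.I * α * y)) := by
    rw [← Complex.exp_add]
    ring_nf
  simp only [kernelM, h0, if_false, e1, e2, e3, kernelMAux]
  ring

theorem measurable_kernelM (a : ℝ) (h0 : α ≠ 0) : Measurable (Function.uncurry (kernelM a α)) := by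
  have h : Measurable fun p : ℝ × ℝ => ((Real.sign (p.2 - p.1) : ℝ) : ℂ) :=
    Complex.measurable_ofReal.comp (measurable_sign.comp (measurable_snd.sub measurable_fst))
  have h1 : Measurable fun p : ℝ × ℝ => kernelMAux a α p.2 :=
    (continuous_kernelMAux a α).measurable.comp measurable_snd
  have e : Function.uncurry (kernelM a α) = fun p : ℝ × ℝ =>
      Complex.exp (-(Complex.I * α * p.1)) * (kernelMAux a α p.2
      + Complex.I * α / 2 * (Real.sign (p.2 - p.1) * Complex.exp (Complex.I * α * p.2))) := by
    ext p
    exact kernelM_eq h0 p.1 p.2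
  rw [e]
  fun_prop

theorem norm_exp_I_mul (s x : ℝ) : ‖Complex.exp (Complex.I * s * x)‖ = 1 := by
  have : Complex.I * s * x = ((s * x : ℝ) : ℂ) * Complex.I := by
    push_cast
    ring
  rw [this, Complex.norm_exp_ofReal_mul_I]

theorem exists_bound_kernelM (h0 : α ≠ 0) :
    ∃ C, ∀ x ∈ Icc (-a) a, ∀ y ∈ Icc (-a) a, ‖kernelM a α x y‖ ≤ C := by
  obtain ⟨C, hC⟩ := (isCompact_Icc (a := -a) (b := a)).exists_bound_of_continuousOn
    (continuous_kernelMAux a α).continuousOn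
  refine ⟨C + ‖Complex.I * α / 2‖, fun x _ y hy => ?_⟩
  have e : ‖Complex.exp (-(Complex.I * α * x))‖ = 1 := by
    have := norm_exp_I_mul (-α) x
    push_cast at this
    rwa [mul_neg, neg_mul] at this
  rw [kernelM_eq h0, norm_mul, e, one_mul]
  refine (norm_add_le _ _).trans (add_le_add (hC y hy) ?_)
  rw [norm_mul, norm_mul, Complex.norm_real, norm_exp_I_mul, mul_one]
  exact mul_le_of_le_one_right (norm_nonneg _) (abs_sign_le _)

theorem integral_kernelM_mul (ha : 0 < a) (h0 : α ≠ 0) (f : L2 a) {x : ℝ} (hx : x ∈ Icc (-a) a) :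
    ∫ y, kernelM a α x y * f y ∂(mu a) = Complex.exp (-(Complex.I * α * x)) *
      (((∫ y, kernelMAux a α y * f y ∂(mu a))
        + Complex.I * α / 2 * ∫ y : ℝ, Complex.exp (Complex.I * α * y) * f y ∂(mu a))
        + ∫ y in (-a)..x, -(Complex.I * α) * (Complex.exp (Complex.I * α * y) * f y)) := by
  have i1 : Integrable (fun y => kernelMAux a α y * f y) (mu a) :=
    integrable_mul_coe (continuous_kernelMAux a α) f
  have i2 : Integrable (fun y : ℝ => Complex.exp (Complex.I * α * y) * f y) (mu a) :=
    integrable_mul_coe (by fun_prop) f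
  have e : ∀ y : ℝ, kernelM a α x y * f y = Complex.exp (-(Complex.I * α * x)) *
      (kernelMAux a α y * f y + Complex.I * α / 2 * (((Real.sign (y - x) : ℝ) : ℂ)
        * (Complex.exp (Complex.I * α * y) * f y))) := by
    intro y
    rw [kernelM_eq h0]
    ring
  simp only [e]
  rw [integral_const_mul, integral_add i1 ((integrable_sign_mul i2 x).const_mul _),
    integral_const_mul, integral_sign_mul ha ((intervalIntegrable_iff_mu ha).2 i2) hx,
    intervalIntegral.integral_const_mul, integral_mu ha (fun y : ℝ => Complex.exp (Complex.I * α * y) * f y)]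
  ring

/-- `T f` is `e^{-iαx}` times a primitive of `-iα e^{iαx} f`, which gives the differential equation.
The `y`-dependent terms of the kernel supply the constant of integration that makes the last
identity true. -/
theorem exists_operator_kernelM_of_ne_zero (ha : 0 < a) (hα : NonResonant a α) (h0 : α ≠ 0) :
    ∃ T : L2 a →L[ℂ] L2 a, IsIntegralOperator a T (kernelM a α) ∧
    (∀ f, IsWeakDeriv a (T f) (-(Complex.I * α) • (f + T f))) ∧
    ∀ f, inner ℂ (phi a α 0) (f + T f) = (inner ℂ (chiN a 0) f : ℂ) := by
  obtain ⟨C, hC⟩ := exists_bound_kernelM (a := a) h0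
  obtain ⟨T, hT⟩ := exists_isIntegralOperator (measurable_kernelM a h0) hC
  have hexp (s : ℂ) (x : ℝ) : HasDerivAt (fun x : ℝ => Complex.exp (-(s * x)))
      (-s * Complex.exp (-(s * x))) x := by
    have h1 : HasDerivAt (fun x : ℝ => -(s * (x : ℂ))) (-(s * 1)) x :=
      (((hasDerivAt_id x).ofReal_comp).const_mul s).neg
    refine h1.cexp.congr_deriv ?_
    ring
  have hpe (s : ℂ) : HasPrim a (fun x : ℝ => Complex.exp (-(s * x)))
      (fun x => -s * Complex.exp (-(s * x))) :=
    HasPrim.of_hasDerivAt (hexp s) (by fun_prop)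
  have hprim (f : L2 a) (c : ℂ) : HasPrim a (fun x => c + ∫ y in (-a)..x,
      -(Complex.I * α) * (Complex.exp (Complex.I * α * y) * f y))
      (fun y : ℝ => -(Complex.I * α) * (Complex.exp (Complex.I * α * y) * f y)) :=
    HasPrim.primitive ((intervalIntegrable_iff_mu ha).2
      ((integrable_mul_coe (by fun_prop) f).const_mul _)) c
  have hTf (f : L2 a) := (hT.2 f).trans (show _ =ᵐ[mu a] _ by
    filter_upwards [ae_mu_mem a] with x hx
    exact integral_kernelM_mul ha h0 f hx)
  have hee (x : ℝ) : Complex.exp (-(Complex.I * α * x)) * Complex.exp (Complex.I * α * x) = 1 := by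
    rw [← Complex.exp_add]
    simp
  refine ⟨T, hT, fun f => ?_, fun f => ?_⟩
  · refine (((hpe (Complex.I * α)).mul ha (hprim f _)).congr_right ha ?_).isWeakDeriv ha (hTf f)
    filter_upwards [hTf f, coe_smul_ae (-(Complex.I * α)) (f + T f), coe_add_ae f (T f)]
      with x h1 h2 h3
    rw [h2, h3, h1]
    linear_combination -(Complex.I * α) * f x * hee x
  · rw [inner_chiN_zero, inner_phi_zero]
    congr 1
    set c := ((∫ y, kernelMAux a α y * f y ∂(mu a))
        + Complex.I * α / 2 * ∫ y : ℝ, Complex.exp (Complex.I * α * y) * f y ∂(mu a)) with hc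
    -- Write `T f = e^{-iαx} U`. Integrating the derivative of `e^{-2iαx} U` gives a linear equation
    -- for the integral of `e^{-iαx} T f`, in which the boundary factors produce `sin(2αa)`.
    have h1 := ((hpe (2 * (Complex.I * α))).mul ha (hprim f c)).integral_eq ha
    have hfi : Integrable f (mu a) := (Lp.memLp f).integrable (by norm_num)
    have iE : Integrable (fun y : ℝ => Complex.exp (Complex.I * α * y) * f y) (mu a) :=
      integrable_mul_coe (by fun_prop) f
    have iX : Integrable (fun y : ℝ => Complex.exp (-(Complex.I * α * y)) * T f y) (mu a) :=
      integrable_mul_coe (by fun_prop) (T f)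
    have iY : Integrable (fun y : ℝ => Complex.exp (-(Complex.I * α * y)) * f y) (mu a) :=
      integrable_mul_coe (by fun_prop) f
    have h2 : ∫ x : ℝ, ((-(2 * (Complex.I * α)) * Complex.exp (-(2 * (Complex.I * α) * x))) *
          (c + ∫ y in (-a)..x, -(Complex.I * α) * (Complex.exp (Complex.I * α * y) * f y))
        + Complex.exp (-(2 * (Complex.I * α) * x)) *
          (-(Complex.I * α) * (Complex.exp (Complex.I * α * x) * f x))) ∂(mu a)
        = -(2 * (Complex.I * α)) * ∫ x : ℝ, Complex.exp (-(Complex.I * α * x)) * T f x ∂(mu a)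
          + -(Complex.I * α) * ∫ x : ℝ, Complex.exp (-(Complex.I * α * x)) * f x ∂(mu a) := by
      rw [← integral_const_mul, ← integral_const_mul,
        ← integral_add (iX.const_mul _) (iY.const_mul _)]
      refine integral_congr_ae ?_
      filter_upwards [hTf f] with x h
      have e2 : Complex.exp (-(2 * (Complex.I * α) * x))
          = Complex.exp (-(Complex.I * α * x)) * Complex.exp (-(Complex.I * α * x)) := by
        rw [← Complex.exp_add]
        ring_nf
      rw [h, e2]
      linear_combination -(Complex.I * α) * f x * Complex.exp (-(Complex.I * α * x)) * hee x
    rw [h2, intervalIntegral.integral_const_mul, intervalIntegral.integral_same, add_zero,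
      ← integral_mu ha (fun y : ℝ => _ * f y)] at h1
    have h3 : ∫ x : ℝ, Complex.exp (-(Complex.I * α * (x + a))) * (f + T f : L2 a) x ∂(mu a)
        = Complex.exp (-(Complex.I * α * a)) *
          (∫ x : ℝ, Complex.exp (-(Complex.I * α * x)) * f x ∂(mu a)
            + ∫ x : ℝ, Complex.exp (-(Complex.I * α * x)) * T f x ∂(mu a)) := by
      rw [← integral_add iY iX, ← integral_const_mul]
      refine integral_congr_ae ?_
      filter_upwards [coe_add_ae f (T f)] with x h
      have e2 : Complex.exp (-(Complex.I * α * (x + a)))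
          = Complex.exp (-(Complex.I * α * x)) * Complex.exp (-(Complex.I * α * a)) := by
        rw [← Complex.exp_add]
        ring_nf
      rw [h, e2]
      ring
    have h4 : ∫ y, kernelMAux a α y * f y ∂(mu a)
        = α * Complex.exp (Complex.I * α * a) / Complex.sin (2 * α * a) * ∫ y, f y ∂(mu a)
          - α / 2 * Complex.cot (2 * α * a) *
            ∫ y : ℝ, Complex.exp (Complex.I * α * y) * f y ∂(mu a)
          - α / (2 * Complex.sin (2 * α * a)) *
            ∫ y : ℝ, Complex.exp (-(Complex.I * α * y)) * f y ∂(mu a) := by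
      have i5 : Integrable (fun y : ℝ => α * Complex.exp (Complex.I * α * a) /
          Complex.sin (2 * α * a) * f y - α / 2 * Complex.cot (2 * α * a) *
          (Complex.exp (Complex.I * α * y) * f y)) (mu a) :=
        (hfi.const_mul _).sub (iE.const_mul _)
      rw [← integral_const_mul, ← integral_const_mul, ← integral_const_mul,
        ← integral_sub (hfi.const_mul _) (iE.const_mul _), ← integral_sub i5 (iY.const_mul _)]
      refine integral_congr_ae (Eventually.of_forall fun x => ?_)
      simp only [kernelMAux]
      ring
    rw [h3]
    rw [h4] at hc
    set X := ∫ x : ℝ, Complex.exp (-(Complex.I * α * x)) * T f x ∂(mu a)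
    set Y := ∫ x : ℝ, Complex.exp (-(Complex.I * α * x)) * f x ∂(mu a)
    set E := ∫ x : ℝ, Complex.exp (Complex.I * α * x) * f x ∂(mu a)
    set F := ∫ x : ℝ, f x ∂(mu a)
    have hs := hα.sin_ne_zero ha h0
    have hα' : (α : ℂ) ≠ 0 := by exact_mod_cast h0
    have hI := Complex.I_ne_zero
    -- From here on the claim is algebra in `P = e^{iαa}` and `Q = e^{-iαa}`, with `QP = 1`.
    set P := Complex.exp (Complex.I * α * a) with hP
    set Q := Complex.exp (-(Complex.I * α * a)) with hQ
    have hPQ : Q * P = 1 := hee a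
    have hP2 : Complex.exp (2 * α * a * Complex.I) = P * P := by
      rw [hP, ← Complex.exp_add]
      ring_nf
    have hQ2 : Complex.exp (-(2 * α * a) * Complex.I) = Q * Q := by
      rw [hQ, ← Complex.exp_add]
      ring_nf
    have b1 : Complex.exp (-(2 * (Complex.I * α) * a)) = Q * Q := by
      rw [← hQ2]
      ring_nf
    have b2 : Complex.exp (-(2 * (Complex.I * α) * ((-a : ℝ) : ℂ))) = P * P := by
      rw [← hP2]
      push_cast
      ring_nf
    rw [b1, b2] at h1
    rw [Complex.cot_eq_cos_div_sin] at hc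
    set S := Complex.sin (2 * α * a) with hS
    set D := Complex.cos (2 * α * a) with hD
    have hS' : S = (Q * Q - P * P) * Complex.I / 2 := by rw [hS, Complex.sin, hP2, hQ2]
    have hD' : D = (P * P + Q * Q) / 2 := by rw [hD, Complex.cos, hP2, hQ2]
    -- Clearing the denominator here is where `sin(2αa) ≠ 0` is used.
    have hcS : 2 * S * c = α * (2 * P * F - D * E - Y + Complex.I * S * E) := by
      rw [hc]
      field_simp
    have key : 2 * (X + Y) = 2 * P * F := by
      have h6 : (Complex.I * α) * (2 * (X + Y) - 2 * P * F) = 0 := by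
        have h7 : (Complex.I * α) * (2 * X + Y) = (P * P - Q * Q) * c
            + Complex.I * α * (Q * Q) * E := by
          linear_combination -h1
        have h8 : (P * P - Q * Q) * c = Complex.I * (2 * S * c) := by
          rw [hS']
          linear_combination (-(Q * Q - P * P) * c) * Complex.I_sq
        rw [h8, hcS] at h7
        rw [hD', hS'] at h7
        linear_combination h7 + (Complex.I * α * E * (Q * Q - P * P) / 2) * Complex.I_sq
      have h9 := (mul_eq_zero.1 h6).resolve_left (mul_ne_zero hI hα')
      linear_combination h9
    linear_combination (Q / 2) * key + F * hPQ

theorem exists_operator_kernelM (ha : 0 < a) (hα : NonResonant a α) :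
    ∃ T : L2 a →L[ℂ] L2 a, IsIntegralOperator a T (kernelM a α) ∧
    (∀ f, IsWeakDeriv a (T f) (-(Complex.I * α) • (f + T f))) ∧
    ∀ f, inner ℂ (phi a α 0) (f + T f) = (inner ℂ (chiN a 0) f : ℂ) := by
  by_cases h0 : α = 0
  · subst h0
    have e : kernelM a 0 = fun _ _ => 0 := by
      ext x y
      simp [kernelM]
    -- For `α = 0` the kernel is zero and `φ_0 = χ_0`, so `T = 0` works.
    refine ⟨0, ⟨?_, fun f => ?_⟩, fun f => ?_, fun f => ?_⟩
    · rw [e]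
      exact MemLp.zero
    · filter_upwards [Lp.coeFn_zero ℂ 2 (mu a)] with x hx
      rw [e]
      simpa using hx
    · simpa using isWeakDeriv_zero a
    · rw [inner_phi_zero, inner_chiN_zero]
      simp
  · exact exists_operator_kernelM_of_ne_zero ha hα h0

/-! ### Derivatives of the eigenfunctions and construction of `Ω`. -/

theorem IsWeakDeriv.sub {f g f' g' : L2 a} (h : IsWeakDeriv a f f') (h' : IsWeakDeriv a g g') :
    IsWeakDeriv a (f - g) (f' - g') := by
  have := h.add (h'.smul (-1))
  simpa [sub_eq_add_neg] using this

theorem IsWeakDeriv.unique {f g g' : L2 a} (h : IsWeakDeriv a f g) (h' : IsWeakDeriv a f g') :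
    g = g' := by
  have := h.sub h'
  rw [sub_self] at this
  exact sub_eq_zero.1 this.eq_zero

/-- `χ_n^D ∈ L²(-a, a)`. -/
def chiD (a : ℝ) (n : ℕ) : L2 a := ofCont a (chiDFun a n) (continuous_chiDFun a n)

theorem isWeakDeriv_chiN (ha : 0 < a) (n : ℕ) :
    IsWeakDeriv a (chiN a n) (-(k a n : ℂ) • chiD a n) := by
  refine ((HasPrim.of_hasDerivAt (hasDerivAt_chiNFun n) ?_).congr_right ha ?_).isWeakDeriv ha
    (ofCont_ae _ _)
  · have := continuous_chiDFun a n
    fun_prop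
  · filter_upwards [coe_smul_ae (-(k a n : ℂ)) (chiD a n),
      ofCont_ae (a := a) _ (continuous_chiDFun a n)] with x h1 h2
    rw [h1, chiD, h2, neg_mul]

theorem isWeakDeriv_chiD (ha : 0 < a) (n : ℕ) :
    IsWeakDeriv a (chiD a n) ((k a n : ℂ) • chiN a n) := by
  refine ((HasPrim.of_hasDerivAt (hasDerivAt_chiDFun n) ?_).congr_right ha ?_).isWeakDeriv ha
    (ofCont_ae _ _)
  · have := continuous_chiNFun a n
    fun_prop
  · filter_upwards [coe_smul_ae (k a n : ℂ) (chiN a n),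
      ofCont_ae (a := a) _ (continuous_chiNFun a n)] with x h1 h2
    rw [h1, chiN, h2]

/-- The derivative is arranged as `ψ_n' + iαψ_n = (χ_n^N)'`, which is `Ωψ_n = χ_n` up to a constant.
For `n ≥ 1` it amounts to `r (k_n² - α²) = k_n²` for the prefactor `r` of `ψ_n`. -/
theorem hasDerivAt_psiFun (ha : 0 < a) (hα : NonResonant a α) (n : ℕ) (x : ℝ) :
    HasDerivAt (psiFun a α n) (-(k a n * chiDFun a n x) - Complex.I * α * psiFun a α n x) x := by
  by_cases hn : n = 0
  · subst hn
    have h1 : HasDerivAt (fun x : ℝ => -(Complex.I * α * ((x : ℂ) + a))) (-(Complex.I * α * 1)) x :=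
      ((((hasDerivAt_id x).ofReal_comp).add_const (a : ℂ)).const_mul _).neg
    have e : psiFun a α 0 = fun x : ℝ => A0 a α * Complex.exp (-(Complex.I * α * (x + a))) := by
      ext x
      simp [psiFun]
    rw [e]
    refine (h1.cexp.const_mul (A0 a α)).congr_deriv ?_
    rw [k_zero]
    push_cast
    ring
  · have e : psiFun a α n = fun x : ℝ => (((k a n) ^ 2 / ((k a n) ^ 2 - α ^ 2) : ℝ) : ℂ) *
        (chiNFun a n x - Complex.I * ((α / k a n : ℝ) : ℂ) * chiDFun a n x) := by
      ext x
      simp only [psiFun, hn, if_false]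
    have hk : (k a n : ℂ) ≠ 0 := by exact_mod_cast (k_pos ha hn).ne'
    have hd : (k a n : ℂ) ^ 2 - (α : ℂ) ^ 2 ≠ 0 := by
      exact_mod_cast sub_ne_zero.2 (hα.sq_ne ha hn)
    rw [e]
    refine (((hasDerivAt_chiNFun n x).fun_sub
      ((hasDerivAt_chiDFun n x).const_mul _)).const_mul _).congr_deriv ?_
    push_cast
    field_simp
    linear_combination (-(α : ℂ) ^ 2 * chiDFun a n x) * Complex.I_sq

theorem isWeakDeriv_psi (ha : 0 < a) (hα : NonResonant a α) (n : ℕ) :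
    IsWeakDeriv a (psi a α n) (-(k a n : ℂ) • chiD a n - (Complex.I * α) • psi a α n) := by
  refine ((HasPrim.of_hasDerivAt (hasDerivAt_psiFun ha hα n) ?_).congr_right ha ?_).isWeakDeriv ha
    (ofCont_ae _ _)
  · have := continuous_chiDFun a n
    have := continuous_psiFun a α n
    fun_prop
  · filter_upwards [coe_smul_ae (-(k a n : ℂ)) (chiD a n),
      ofCont_ae (a := a) _ (continuous_chiDFun a n), coe_smul_ae (Complex.I * α) (psi a α n),
      ofCont_ae (a := a) _ (continuous_psiFun a α n),
      Lp.coeFn_sub (-(k a n : ℂ) • chiD a n) ((Complex.I * α) • psi a α n)] with x h1 h2 h3 h4 h5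
    rw [h5, Pi.sub_apply, h1, chiD, h2, h3, psi, h4, neg_mul]

theorem inner_chiN_zero_const (ha : 0 < a) (c : ℂ) :
    inner ℂ (chiN a 0) (const a c) = ((1 / √(2 * a) : ℝ) : ℂ) * (2 * a * c) := by
  rw [inner_chiN_zero, ← integral_mu_const ha, const,
    integral_congr_ae (ofCont_ae (a := a) _ continuous_const)]

theorem one_div_sqrt_ne_zero (ha : 0 < a) : ((1 / √(2 * a) : ℝ) : ℂ) ≠ 0 := by
  rw [Complex.ofReal_ne_zero]
  exact one_div_ne_zero (Real.sqrt_ne_zero'.2 (by linarith))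

/-- An element with vanishing weak derivative and vanishing mean is zero. -/
theorem IsWeakDeriv.eq_zero_of_inner (ha : 0 < a) {f : L2 a} (h : IsWeakDeriv a f 0)
    (h0 : inner ℂ (chiN a 0) f = (0 : ℂ)) : f = 0 := by
  obtain ⟨c, rfl⟩ := h.exists_eq_const ha
  rw [inner_chiN_zero_const ha] at h0
  have ha' : (a : ℂ) ≠ 0 := by exact_mod_cast ha.ne'
  have hc : c = 0 := by
    have := (mul_eq_zero.1 h0).resolve_left (one_div_sqrt_ne_zero ha)
    simpa [ha'] using this
  subst hc
  refine Lp.ext ?_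
  filter_upwards [ofCont_ae (a := a) (fun _ => (0 : ℂ)) continuous_const,
    Lp.coeFn_zero ℂ 2 (mu a)] with x h1 h2
  rw [const, h1, h2, Pi.zero_apply]

theorem A0_ne_zero (ha : 0 < a) (hα : NonResonant a α) : A0 a α ≠ 0 := by
  unfold A0
  split_ifs with h0
  · exact one_div_sqrt_ne_zero ha
  · have hs := hα.sin_ne_zero ha h0
    have h1 : ((√(2 * a) : ℝ) : ℂ) ≠ 0 :=
      Complex.ofReal_ne_zero.2 (Real.sqrt_ne_zero'.2 (by linarith))
    have h2 : (α : ℂ) ≠ 0 := by exact_mod_cast h0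
    exact div_ne_zero (mul_ne_zero (mul_ne_zero h2 (Complex.exp_ne_zero _)) h1) hs

/-- The solutions of `f' = -iα f` are the multiples of `ψ_0`. -/
theorem exists_eq_smul_psi_zero (ha : 0 < a) (hα : NonResonant a α) {f : L2 a}
    (hf : IsWeakDeriv a f (-(Complex.I * α) • f)) : ∃ d : ℂ, f = d • psi a α 0 := by
  obtain ⟨u, hu, hfu⟩ := hf.exists_hasPrim ha
  have hd (x : ℝ) : HasDerivAt (fun x : ℝ => Complex.exp (Complex.I * α * (x + a)))
      (Complex.I * α * Complex.exp (Complex.I * α * (x + a))) x := by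
    have h1 : HasDerivAt (fun x : ℝ => Complex.I * α * ((x : ℂ) + a)) (Complex.I * α * 1) x :=
      (((hasDerivAt_id x).ofReal_comp).add_const (a : ℂ)).const_mul _
    refine h1.cexp.congr_deriv ?_
    ring
  -- The product `e^{iα(x+a)} f` has derivative zero, so it equals its value `u(-a)` at the left
  -- end; the coefficient divides by `ψ_0(-a) = A_0`.
  have hw := ((HasPrim.of_hasDerivAt (a := a) hd (by fun_prop)).mul ha hu).congr_right
    (h := fun _ => 0) ha (by
      filter_upwards [hfu, coe_smul_ae (-(Complex.I * α)) f] with x h1 h2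
      rw [h2, h1]
      ring)
  have hA := A0_ne_zero ha hα
  refine ⟨u (-a) / A0 a α, Lp.ext ?_⟩
  filter_upwards [hfu, coe_smul_ae (u (-a) / A0 a α) (psi a α 0),
    ofCont_ae (a := a) _ (continuous_psiFun a α 0), ae_mu_mem a] with x h1 h2 h3 hx
  have h4 := hw.2 x hx
  simp only [intervalIntegral.integral_zero, add_zero] at h4
  have h5 : Complex.exp (-(Complex.I * α * (x + a))) * Complex.exp (Complex.I * α * (x + a)) = 1 := by
    rw [← Complex.exp_add]
    simp
  have h6 : Complex.exp (Complex.I * α * (((-a : ℝ) : ℂ) + a)) = 1 := by simp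
  rw [h6, one_mul] at h4
  rw [h1, h2, psi, h3]
  simp only [psiFun, if_true]
  rw [← h4]
  field_simp
  linear_combination -(u x) * h5

/-- The similarity transformation `Ω`. -/
theorem exists_similarity (ha : 0 < a) (hα : NonResonant a α) : ∃ Ω : L2 a ≃L[ℂ] L2 a,
    IsIntegralOperator a ((Ω : L2 a →L[ℂ] L2 a) - ContinuousLinearMap.id ℂ _) (kernelL a α) ∧
    IsIntegralOperator a ((Ω.symm : L2 a →L[ℂ] L2 a) - ContinuousLinearMap.id ℂ _)
      (kernelM a α) ∧
    (∀ n, Ω (psi a α n) = chiN a n) ∧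
    ∀ f, IsWeakDeriv a (Ω.symm f - f) (-(Complex.I * α) • Ω.symm f) := by
  obtain ⟨S, hS, hSd, hS0⟩ := exists_operator_kernelL ha α
  obtain ⟨T, hT, hTd, hT0⟩ := exists_operator_kernelM ha hα
  -- To identify `Ωf` with `g` it suffices to compare derivatives and the single coefficient against
  -- `χ_0`.
  have huniq (f g : L2 a) (h : IsWeakDeriv a (f + S f - g) 0)
      (h0 : inner ℂ (phi a α 0) f = (inner ℂ (chiN a 0) g : ℂ)) : f + S f = g :=
    sub_eq_zero.1 (h.eq_zero_of_inner ha (by rw [inner_sub_right, hS0, h0, sub_self]))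
  have hright (f : L2 a) : (f + T f) + S (f + T f) = f := by
    refine huniq _ _ ?_ (hT0 f)
    have e : f + T f + S (f + T f) - f = T f + S (f + T f) := by abel
    rw [e]
    have h := (hTd f).add (hSd (f + T f))
    rwa [neg_smul, neg_add_cancel] at h
  have hinj (f : L2 a) (hf : f + S f = 0) : f = 0 := by
    have h1 : IsWeakDeriv a f (-(Complex.I * α) • f) := by
      have e : f = (-1 : ℂ) • S f := by
        rw [neg_one_smul]
        exact eq_neg_of_add_eq_zero_left hf
      have := (hSd f).smul (-1)
      rw [← e, smul_smul, neg_one_mul] at this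
      exact this
    obtain ⟨d, hd⟩ := exists_eq_smul_psi_zero ha hα h1
    have h2 := hS0 f
    rw [hf, inner_zero_right, hd, inner_smul_right, inner_phi_psi_self ha hα, mul_one] at h2
    rw [hd, ← h2, zero_smul]
  let A : L2 a →L[ℂ] L2 a := ContinuousLinearMap.id ℂ _ + S
  let B : L2 a →L[ℂ] L2 a := ContinuousLinearMap.id ℂ _ + T
  have hAB (f : L2 a) : A (B f) = f := hright f
  -- A right inverse of an injective map is two-sided.
  have hBA (f : L2 a) : B (A f) = f := by
    refine sub_eq_zero.1 (hinj _ ?_)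
    change A (B (A f) - f) = 0
    rw [map_sub, hAB, sub_self]
  refine ⟨ContinuousLinearEquiv.equivOfInverse A B hBA hAB, ?_, ?_, fun n => ?_, fun f => ?_⟩
  · convert hS using 1
    ext1 f
    exact add_sub_cancel_left f (S f)
  · convert hT using 1
    ext1 f
    exact add_sub_cancel_left f (T f)
  · refine huniq (psi a α n) _ ?_ ?_
    · have h1 := ((isWeakDeriv_psi ha hα n).add (hSd (psi a α n))).sub (isWeakDeriv_chiN ha n)
      simpa using h1
    · by_cases hn : n = 0
      · subst hn
        rw [inner_phi_psi_self ha hα, inner_chiN_self ha]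
      · rw [inner_phi_psi_of_ne ha hα (Ne.symm hn), inner_chiN_of_ne ha (Ne.symm hn)]
  · have e : f + T f - f = T f := add_sub_cancel_left f (T f)
    change IsWeakDeriv a (f + T f - f) (-(Complex.I * α) • (f + T f))
    rw [e]
    exact hTd f

/-! ### Expansions -/

section Expansions

variable (ha : 0 < a) (hα : NonResonant a α) (Ω : L2 a ≃L[ℂ] L2 a)
  (hΩ : ∀ n, Ω (psi a α n) = chiN a n)

include ha hΩ

theorem hasSum_psi (f : L2 a) :
    HasSum (fun n => inner ℂ (chiN a n) f • psi a α n) (Ω.symm f) := by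
  have h := (hasSum_chiN ha f).mapL (Ω.symm : L2 a →L[ℂ] L2 a)
  simpa [← hΩ] using h

include hα

/-- Expand `f = Ω⁻¹(Ωf)` in the `ψ_m` and pair with `φ_n`; biorthogonality leaves one term. -/
theorem inner_chiN_similarity (n : ℕ) (f : L2 a) :
    inner ℂ (chiN a n) (Ω f) = (inner ℂ (phi a α n) f : ℂ) := by
  have h := (hasSum_psi ha Ω hΩ (Ω f)).mapL (innerSL ℂ (phi a α n))
  simp only [ContinuousLinearEquiv.symm_apply_apply, map_smul, innerSL_apply_apply,
    inner_phi_psi ha hα, smul_eq_mul, mul_ite, mul_one, mul_zero] at h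
  have h2 := hasSum_ite_eq n (inner ℂ (chiN a n) (Ω f) : ℂ)
  refine HasSum.unique ?_ h
  have e : (fun m => if n = m then (inner ℂ (chiN a m) (Ω f) : ℂ) else 0)
      = fun m => if m = n then inner ℂ (chiN a n) (Ω f) else 0 := by
    ext m
    by_cases hm : n = m
    · simp [hm]
    · simp [hm, Ne.symm hm]
  rwa [e]

theorem hasSum_similarity (f : L2 a) :
    HasSum (fun n => inner ℂ (phi a α n) f • chiN a n) (Ω f) := by
  have h := hasSum_chiN ha (Ω f)
  simpa only [inner_chiN_similarity ha hα Ω hΩ] using h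

end Expansions

/-! ### The self-adjoint operator `h` -/

theorem hOp_apply (y : (robin a 0 0).domain) : hOp a α (⟨y, y.2⟩ : (hOp a α).domain)
    = ((α : ℂ) ^ 2 * inner ℂ (chiN a 0) (y : L2 a)) • chiN a 0 + robin a 0 0 y := by
  change ((α : ℂ) ^ 2 • InnerProductSpace.rankOne ℂ (chiN a 0) (chiN a 0) : L2 a →L[ℂ] L2 a)
    (y : L2 a) + robin a 0 0 y = _
  rw [_root_.smul_apply, InnerProductSpace.rankOne_apply, smul_smul]

theorem mem_hOp_graph_iff (u w : L2 a) :
    (u, w) ∈ (hOp a α).graph ↔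
      (u, w - ((α : ℂ) ^ 2 * inner ℂ (chiN a 0) u) • chiN a 0) ∈ robinGraph a 0 0 := by
  rw [← robin_graph, LinearPMap.mem_graph_iff, LinearPMap.mem_graph_iff]
  constructor
  · rintro ⟨y, rfl, hy⟩
    refine ⟨⟨y, y.2⟩, rfl, ?_⟩
    have h := hOp_apply (α := α) ⟨(y : L2 a), y.2⟩
    exact eq_sub_of_add_eq' (h.symm.trans hy)
  · rintro ⟨y, rfl, hy⟩
    refine ⟨⟨y, y.2⟩, rfl, ?_⟩
    rw [hOp_apply, hy]
    exact add_sub_cancel _ _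

theorem inner_chiN_of_mem_neumann (ha : 0 < a) {u w : L2 a} (h : (u, w) ∈ robinGraph a 0 0)
    (n : ℕ) : inner ℂ (chiN a n) w = (k a n : ℂ) ^ 2 * inner ℂ (chiN a n) u := by
  rw [robinGraph_inner ha h (by simpa using chiN_mem_neumann ha n), inner_smul_left]
  simp

/-- Solvability of the Neumann problem for data with vanishing mean. -/
theorem exists_mem_neumann (ha : 0 < a) {w : L2 a} (h : inner ℂ (chiN a 0) w = (0 : ℂ)) :
    ∃ v, (v, w) ∈ robinGraph a 0 0 := by
  have h1 : ∫ x in (-a)..a, (-w : L2 a) x = 0 := by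
    rw [inner_chiN_zero] at h
    have h2 := (mul_eq_zero.1 h).resolve_left (one_div_sqrt_ne_zero ha)
    rw [← integral_mu ha, integral_congr_ae (Lp.coeFn_neg w)]
    simp only [Pi.neg_apply]
    rw [integral_neg, h2, neg_zero]
  -- Integrate `-w` twice from `-a`. The first primitive is the derivative of the solution: it
  -- vanishes at `-a` by construction and at `a` because `w` has mean zero.
  have hG := HasPrim.primitive (intervalIntegrable_coe ha (-w)) 0
  obtain ⟨g, hg⟩ := exists_L2_of_hasPrim hG
  have hV := HasPrim.primitive (intervalIntegrable_coe ha g) 0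
  obtain ⟨v, hv⟩ := exists_L2_of_hasPrim hV
  refine ⟨v, g, hV.isWeakDeriv ha hv, hG.isWeakDeriv ha hg, _, _, hV.isContRep hv,
    hG.isContRep hg, ?_, ?_⟩
  · simpa only [zero_add, zero_mul, add_zero] using h1
  · simp

/-- The graph of the Neumann Laplacian in terms of Fourier coefficients. -/
theorem mem_neumann_of_inner_chiN (ha : 0 < a) {u w : L2 a}
    (h : ∀ n, inner ℂ (chiN a n) w = (k a n : ℂ) ^ 2 * inner ℂ (chiN a n) u) :
    (u, w) ∈ robinGraph a 0 0 := by
  obtain ⟨v, hv⟩ := exists_mem_neumann ha (w := w) (by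
    rw [h 0, k_zero]
    simp)
  -- For `n ≥ 1` the coefficients of `u` and `v` agree because `k_n ≠ 0`, so they differ by a
  -- multiple of `χ_0`, which is itself a Neumann solution with right-hand side zero.
  have e : u = v + (inner ℂ (chiN a 0) (u - v) : ℂ) • chiN a 0 := by
    refine eq_of_inner_chiN ha fun n => ?_
    rw [inner_add_right, inner_smul_right]
    by_cases hn : n = 0
    · subst hn
      rw [inner_chiN_self ha, inner_sub_right]
      ring
    · have hk : (k a n : ℂ) ^ 2 ≠ 0 := pow_ne_zero _ (by exact_mod_cast (k_pos ha hn).ne')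
      rw [inner_chiN_of_ne ha hn, mul_zero, add_zero]
      refine mul_left_cancel₀ hk ?_
      rw [← h n, inner_chiN_of_mem_neumann ha hv n]
  have h0 := Submodule.smul_mem _ (inner ℂ (chiN a 0) (u - v) : ℂ) (chiN_mem_neumann ha 0)
  have h1 := Submodule.add_mem _ hv h0
  rw [k_zero] at h1
  rw [e]
  simpa using h1

/-- The rank-one term moves only the eigenvalue at `n = 0`, from `k_0² = 0` to `α²`. -/
theorem eig_eq (n : ℕ) : (eig a α n : ℂ) = (k a n : ℂ) ^ 2 + if n = 0 then (α : ℂ) ^ 2 else 0 := by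
  by_cases hn : n = 0
  · subst hn
    simp [eig, k_zero]
  · simp [eig, hn]

theorem inner_chiN_smul_chiN_zero (ha : 0 < a) (n : ℕ) (u : L2 a) :
    inner ℂ (chiN a n) (((α : ℂ) ^ 2 * inner ℂ (chiN a 0) u) • chiN a 0)
      = (if n = 0 then (α : ℂ) ^ 2 else 0) * inner ℂ (chiN a n) u := by
  rw [inner_smul_right]
  by_cases hn : n = 0
  · subst hn
    rw [inner_chiN_self ha, mul_one, if_pos rfl]
  · simp [inner_chiN_of_ne ha hn, hn]

/-- The operator `h` is diagonal in the basis of the Neumann eigenfunctions. -/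
theorem mem_hOp_graph_iff_inner (ha : 0 < a) (u w : L2 a) :
    (u, w) ∈ (hOp a α).graph ↔
      ∀ n, inner ℂ (chiN a n) w = (eig a α n : ℂ) * inner ℂ (chiN a n) u := by
  rw [mem_hOp_graph_iff]
  constructor
  · intro h n
    have h1 := inner_chiN_of_mem_neumann ha h n
    rw [inner_sub_right, inner_chiN_smul_chiN_zero ha] at h1
    rw [eig_eq]
    linear_combination h1
  · intro h
    refine mem_neumann_of_inner_chiN ha fun n => ?_
    rw [inner_sub_right, inner_chiN_smul_chiN_zero ha, h, eig_eq]
    ring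

theorem chiN_mem_hOp_graph (ha : 0 < a) (n : ℕ) :
    (chiN a n, (eig a α n : ℂ) • chiN a n) ∈ (hOp a α).graph := by
  rw [mem_hOp_graph_iff_inner ha]
  intro m
  rw [inner_smul_right]
  by_cases h : m = n
  · rw [h]
  · rw [inner_chiN_of_ne ha h, mul_zero, mul_zero]

theorem dense_hOp_domain (ha : 0 < a) : Dense ((hOp a α).domain : Set (L2 a)) :=
  dense_of_chiN_mem ha _ fun n => LinearPMap.mem_domain_of_mem_graph (chiN_mem_hOp_graph ha n)

/-- Testing the adjoint relation against the `χ_n` gives the coefficient description of the graph.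
The converse is Parseval's identity, termwise, with real `λ_n`. -/
theorem isSelfAdjoint_hOp (ha : 0 < a) : IsSelfAdjoint (hOp a α) := by
  rw [LinearPMap.isSelfAdjoint_def]
  refine LinearPMap.eq_of_eq_graph ?_
  rw [LinearPMap.adjoint_graph_eq_graph_adjoint (dense_hOp_domain ha)]
  ext ⟨u, w⟩
  rw [Submodule.mem_adjoint_iff]
  constructor
  · intro h
    rw [mem_hOp_graph_iff_inner ha]
    intro n
    have h1 := h _ _ (chiN_mem_hOp_graph ha n)
    rw [inner_smul_left, Complex.conj_ofReal] at h1
    exact (sub_eq_zero.1 h1).symm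
  · intro h x y hxy
    rw [mem_hOp_graph_iff_inner ha] at h hxy
    rw [sub_eq_zero, ← (chiNBasis ha).tsum_inner_mul_inner, ← (chiNBasis ha).tsum_inner_mul_inner]
    refine tsum_congr fun n => ?_
    simp only [coe_chiNBasis]
    rw [h n, ← inner_conj_symm y, hxy n, map_mul, Complex.conj_ofReal, inner_conj_symm]
    ring

/-! ### The similarity between `H` and `h` -/

theorem mem_similar_graph_iff {E : Type*} [NormedAddCommGroup E] [NormedSpace ℂ E] (Ω : E ≃L[ℂ] E)
    (T : E →ₗ.[ℂ] E) (u w : E) : (u, w) ∈ (similar Ω T).graph ↔ (Ω.symm u, Ω.symm w) ∈ T.graph := by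
  rw [LinearPMap.mem_graph_iff, LinearPMap.mem_graph_iff]
  constructor
  · rintro ⟨y, rfl, rfl⟩
    refine ⟨⟨Ω.symm y, y.2⟩, rfl, ?_⟩
    exact (Ω.symm_apply_apply _).symm
  · rintro ⟨y, hy, hw⟩
    have hu : Ω.symm u ∈ T.domain := by
      have h := y.2
      rwa [show (y : E) = Ω.symm u from hy] at h
    refine ⟨⟨u, hu⟩, rfl, ?_⟩
    have e : (⟨Ω.symm u, hu⟩ : T.domain) = y := Subtype.ext hy.symm
    change Ω (T ⟨Ω.symm u, hu⟩) = w
    rw [e, show T y = Ω.symm w from hw, Ω.apply_symm_apply]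

/-- Pairing with the `φ_n` gives `ΩHΩ⁻¹ ⊆ h` without any regularity argument. For the converse only
the domain is needed: `f = Ω⁻¹u` satisfies `f' = u' - iαf`, so it is in `W^{2,2}` and `f' + iαf =
u'` vanishes at the ends. -/
theorem similar_eq_hOp (ha : 0 < a) (hα : NonResonant a α) (Ω : L2 a ≃L[ℂ] L2 a)
    (hΩ : ∀ n, Ω (psi a α n) = chiN a n)
    (hd : ∀ f, IsWeakDeriv a (Ω.symm f - f) (-(Complex.I * α) • Ω.symm f)) :
    similar Ω (robin a (Complex.I * α) (Complex.I * α)) = hOp a α := by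
  have hle (u w : L2 a)
      (h : (Ω.symm u, Ω.symm w) ∈ robinGraph a (Complex.I * α) (Complex.I * α)) :
      (u, w) ∈ (hOp a α).graph := by
    rw [mem_hOp_graph_iff_inner ha]
    intro n
    have h1 := robinGraph_inner ha h (by
      rw [map_mul, Complex.conj_I, Complex.conj_ofReal, neg_mul]
      exact phi_mem_robinGraph ha α n)
    rw [inner_smul_left, Complex.conj_ofReal, ← inner_chiN_similarity ha hα Ω hΩ,
      ← inner_chiN_similarity ha hα Ω hΩ, Ω.apply_symm_apply, Ω.apply_symm_apply] at h1
    exact h1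
  refine LinearPMap.eq_of_eq_graph ?_
  ext ⟨u, w⟩
  rw [mem_similar_graph_iff, robin_graph]
  refine ⟨hle u w, fun h => ?_⟩
  obtain ⟨d, hd1, hd2, U, V, hU, hV, b1, b2⟩ := (mem_hOp_graph_iff u w).1 h
  have h1 : IsWeakDeriv a (Ω.symm u) (d - (Complex.I * α) • Ω.symm u) := by
    have := hd1.add (hd u)
    rw [add_sub_cancel, neg_smul, ← sub_eq_add_neg] at this
    exact this
  have h2 := hd2.sub (h1.smul (Complex.I * α))
  obtain ⟨p, hp, hup⟩ := h1.exists_hasPrim ha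
  set e := -(-(w - ((α : ℂ) ^ 2 * inner ℂ (chiN a 0) u) • chiN a 0)
    - (Complex.I * α) • (d - (Complex.I * α) • Ω.symm u)) with he
  have key : (Ω.symm u, e) ∈ robinGraph a (Complex.I * α) (Complex.I * α) := by
    refine ⟨_, h1, ?_, p, fun x => V x - Complex.I * α * p x, hp.isContRep hup,
      ⟨hV.1.sub (continuousOn_const.mul hp.continuousOn), ?_⟩, ?_, ?_⟩
    · change IsWeakDeriv a _ (-e)
      rw [he, neg_neg]
      exact h2
    · filter_upwards [Lp.coeFn_sub d ((Complex.I * α) • Ω.symm u), hV.2,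
        coe_smul_ae (Complex.I * α) (Ω.symm u), hup] with x x1 x2 x3 x4
      rw [x1, Pi.sub_apply, x2, x3, x4]
    · linear_combination b1
    · linear_combination b2
  -- The value need not be computed: by the first inclusion `Ω e` is a value of `h` at `u`, and `h`
  -- is single-valued.
  have h3 := hle u (Ω e) (by rwa [Ω.symm_apply_apply])
  have h4 : w = Ω e := LinearPMap.mem_graph_snd_inj _ h h3 rfl
  rw [h4, Ω.symm_apply_apply]
  exact key

/-! ### The quadratic form -/

theorem isWeakDeriv_weakDeriv (u : W12 a) : IsWeakDeriv a u (weakDeriv a u) := by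
  have h := (weakDeriv a).mem_graph u
  rw [weakDeriv_graph] at h
  exact h

theorem IsWeakDeriv.mem_W12 {f g : L2 a} (h : IsWeakDeriv a f g) : f ∈ W12 a :=
  mem_W12_iff.2 ⟨g, h⟩

theorem IsWeakDeriv.weakDeriv_eq {f g : L2 a} (h : IsWeakDeriv a f g) (hf : f ∈ W12 a) :
    weakDeriv a ⟨f, hf⟩ = g :=
  (isWeakDeriv_weakDeriv ⟨f, hf⟩).unique h

theorem dense_W12 (ha : 0 < a) : Dense (W12 a : Set (L2 a)) :=
  dense_of_chiN_mem ha _ fun n => (isWeakDeriv_chiN ha n).mem_W12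

/-- The sesquilinear form `t_h`. -/
def formH (a α : ℝ) : SesqForm (W12 a) :=
  LinearMap.mk₂'ₛₗ (starRingEnd ℂ) (RingHom.id ℂ)
    (fun v u => inner ℂ (weakDeriv a v) (weakDeriv a u)
      + (α : ℂ) ^ 2 * (inner ℂ (v : L2 a) (chiN a 0) * inner ℂ (chiN a 0) (u : L2 a)))
    (fun v v' u => by
      rw [LinearPMap.map_add, Submodule.coe_add, inner_add_left, inner_add_left]
      ring)
    (fun c v u => by
      rw [LinearPMap.map_smul, Submodule.coe_smul, inner_smul_left, inner_smul_left, smul_eq_mul]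
      ring)
    (fun v u u' => by
      rw [LinearPMap.map_add, Submodule.coe_add, inner_add_right, inner_add_right]
      ring)
    (fun c v u => by
      rw [LinearPMap.map_smul, Submodule.coe_smul, inner_smul_right, inner_smul_right,
        RingHom.id_apply, smul_eq_mul]
      ring)

theorem formH_apply (v u : W12 a) : formH a α v u = inner ℂ (weakDeriv a v) (weakDeriv a u)
    + (α : ℂ) ^ 2 * (inner ℂ (v : L2 a) (chiN a 0) * inner ℂ (chiN a 0) (u : L2 a)) := rfl

theorem formH_self (u : W12 a) : formH a α u u =
    ((‖weakDeriv a u‖ ^ 2 + α ^ 2 * ‖inner ℂ (chiN a 0) (u : L2 a)‖ ^ 2 : ℝ) : ℂ) := by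
  rw [formH_apply, inner_self_eq_norm_sq_to_K, ← inner_conj_symm, Complex.conj_mul']
  push_cast
  rfl

/-- Closedness of the weak derivative: for a fixed test function, both sides of the defining
identity are inner products with fixed elements of `L²`, hence continuous. -/
theorem isWeakDeriv_of_tendsto {f g : ℕ → L2 a} {x y : L2 a} (h : ∀ n, IsWeakDeriv a (f n) (g n))
    (hf : Tendsto f atTop (𝓝 x)) (hg : Tendsto g atTop (𝓝 y)) : IsWeakDeriv a x y := by
  intro θ hθ
  have hc (η : ℝ → ℝ) (hη : Continuous η) (f : L2 a) : ∫ x, ((η x : ℝ) : ℂ) * f x ∂(mu a)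
      = inner ℂ (ofCont a (fun x => ((η x : ℝ) : ℂ)) (Complex.continuous_ofReal.comp hη)) f := by
    rw [inner_ofCont_left]
    simp only [Complex.conj_ofReal]
  have h1 := hθ.1.continuous
  have h2 : Continuous (deriv θ) := hθ.1.continuous_deriv (by simp)
  have e (n : ℕ) := h n θ hθ
  simp only [hc _ h1, hc _ h2] at e ⊢
  refine tendsto_nhds_unique (tendsto_const_nhds.inner hf) ?_
  simp only [e]
  exact (tendsto_const_nhds.inner hg).neg

/-- The form dominates `‖ψ'‖²`, so form-Cauchy sequences have Cauchy derivatives, and closedness of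
the weak derivative identifies the limit. The rank-one term is continuous in `L²`. -/
theorem isClosedForm_formH (a α : ℝ) : IsClosedForm (formH a α) := by
  intro u x hu ht
  have hre : Tendsto (fun p : ℕ × ℕ => ‖weakDeriv a (u p.1) - weakDeriv a (u p.2)‖ ^ 2) atTop
      (𝓝 0) := by
    have h1 := (Complex.continuous_re.tendsto _).comp ht
    simp only [Function.comp_def, formH_self, Complex.ofReal_re, Complex.zero_re] at h1
    refine squeeze_zero (fun p => sq_nonneg _) (fun p => ?_) h1
    rw [LinearPMap.map_sub]
    exact le_add_of_nonneg_right (by positivity)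
  have hcau : CauchySeq fun n => weakDeriv a (u n) := by
    rw [cauchySeq_iff_tendsto_dist_atTop_0]
    have h1 := (Real.continuous_sqrt.tendsto _).comp hre
    simpa only [Function.comp_def, Real.sqrt_sq (norm_nonneg _), Real.sqrt_zero, dist_eq_norm]
      using h1
  obtain ⟨g, hg⟩ := cauchySeq_tendsto_of_complete hcau
  have hw : IsWeakDeriv a x g := isWeakDeriv_of_tendsto (fun n => isWeakDeriv_weakDeriv (u n)) hu hg
  refine ⟨hw.mem_W12, ?_⟩
  have h1 : Tendsto (fun n => ‖weakDeriv a (u n) - g‖ ^ 2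
      + α ^ 2 * ‖(inner ℂ (chiN a 0) ((u n : L2 a) - x) : ℂ)‖ ^ 2) atTop (𝓝 0) := by
    have h2 := (tendsto_iff_norm_sub_tendsto_zero.1 hg).pow 2
    have h3 : Tendsto (fun n => (u n : L2 a) - x) atTop (𝓝 0) := by
      simpa using hu.sub_const x
    have h4 := (((tendsto_const_nhds (x := chiN a 0)).inner h3 (𝕜 := ℂ)).norm.pow 2).const_mul (α ^ 2)
    simpa using h2.add h4
  have h2 := (Complex.continuous_ofReal.tendsto _).comp h1
  simp only [formH_self, LinearPMap.map_sub, hw.weakDeriv_eq hw.mem_W12]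
  simpa [Function.comp_def] using h2

/-- Forward, integrate by parts; `u'` vanishes at the ends. Backward, testing with the `χ_n` alone
suffices: integration by parts against `χ_n^D`, which vanishes at the ends, yields the coefficient
relations, and with them the regularity and the Neumann condition. -/
theorem isAssociatedOperator_hOp (ha : 0 < a) : IsAssociatedOperator (formH a α) (hOp a α) := by
  intro u w
  constructor
  · intro h
    obtain ⟨d, hd1, hd2, U, V, hU, hV, b1, b2⟩ := (mem_hOp_graph_iff u w).1 h
    rw [zero_mul, add_zero] at b1 b2
    refine ⟨hd1.mem_W12, fun v => ?_⟩
    obtain ⟨p, hp, hvp⟩ := (isWeakDeriv_weakDeriv v).exists_hasPrim ha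
    have h1 := inner_weakDeriv_add ha (isWeakDeriv_weakDeriv v) hd2 (hp.isContRep hvp) hV
    rw [b1, b2, mul_zero, mul_zero, sub_zero, inner_neg_right, inner_sub_right,
      inner_smul_right] at h1
    rw [formH_apply, hd1.weakDeriv_eq hd1.mem_W12]
    linear_combination h1
  · rintro ⟨hu, h⟩
    rw [mem_hOp_graph_iff_inner ha]
    intro n
    have h1 := h ⟨chiN a n, (isWeakDeriv_chiN ha n).mem_W12⟩
    obtain ⟨p, hp, hup⟩ := (isWeakDeriv_weakDeriv ⟨u, hu⟩).exists_hasPrim ha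
    have h2 := inner_weakDeriv_add ha (isWeakDeriv_chiD ha n) (isWeakDeriv_weakDeriv ⟨u, hu⟩)
      (isContRep_ofCont _) (hp.isContRep hup)
    rw [chiDFun_right ha, chiDFun_left, map_zero, zero_mul, zero_mul, sub_zero, inner_smul_left,
      Complex.conj_ofReal] at h2
    rw [formH_apply, (isWeakDeriv_chiN ha n).weakDeriv_eq, inner_smul_left, map_neg,
      Complex.conj_ofReal] at h1
    have h3 := inner_chiN_smul_chiN_zero (α := α) ha n u
    rw [inner_smul_right] at h3
    rw [eig_eq]
    linear_combination -h1 - k a n * h2 + h3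

end RobinInterval

end

open RobinInterval in
theorem mainTheorem7 (a : ℝ) (ha : 0 < a) (α : ℝ)
    (hα : ∀ n : ℕ, 1 ≤ n → |α| ≠ RobinInterval.k a n) :
    let H := RobinInterval.robin a (Complex.I * α) (Complex.I * α)
    (∀ n, (RobinInterval.psi a α n,
        (RobinInterval.eig a α n : ℂ) • RobinInterval.psi a α n) ∈ H.graph) ∧
    (∀ n, (RobinInterval.phi a α n,
        (RobinInterval.eig a α n : ℂ) • RobinInterval.phi a α n) ∈ H.adjoint.graph) ∧
    (∀ m n, inner ℂ (RobinInterval.psi a α n) (RobinInterval.phi a α m)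
        = if n = m then (1 : ℂ) else 0) ∧
    ∃ Ω : RobinInterval.L2 a ≃L[ℂ] RobinInterval.L2 a,
      (∀ f : RobinInterval.L2 a,
        HasSum (fun n => inner ℂ (RobinInterval.phi a α n) f • RobinInterval.chiN a n) (Ω f)) ∧
      (∀ f : RobinInterval.L2 a,
        HasSum (fun n => inner ℂ (RobinInterval.chiN a n) f • RobinInterval.psi a α n)
          (Ω.symm f)) ∧
      RobinInterval.IsIntegralOperator a
        ((Ω : RobinInterval.L2 a →L[ℂ] RobinInterval.L2 a) - ContinuousLinearMap.id ℂ _)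
        (RobinInterval.kernelL a α) ∧
      RobinInterval.IsIntegralOperator a
        ((Ω.symm : RobinInterval.L2 a →L[ℂ] RobinInterval.L2 a) - ContinuousLinearMap.id ℂ _)
        (RobinInterval.kernelM a α) ∧
      RobinInterval.similar Ω H = RobinInterval.hOp a α ∧
      IsSelfAdjoint (RobinInterval.similar Ω H) ∧
      (∀ n, (RobinInterval.chiN a n,
        (RobinInterval.eig a α n : ℂ) • RobinInterval.chiN a n)
          ∈ (RobinInterval.similar Ω H).graph) ∧
      Dense (RobinInterval.W12 a : Set (RobinInterval.L2 a)) ∧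
      ∃ t : RobinInterval.SesqForm (RobinInterval.W12 a),
        (∀ ψ : RobinInterval.W12 a, t ψ ψ =
          ((‖RobinInterval.weakDeriv a ψ‖ ^ 2
            + α ^ 2 * ‖inner ℂ (RobinInterval.chiN a 0) (ψ : RobinInterval.L2 a)‖ ^ 2 : ℝ) : ℂ)) ∧
        RobinInterval.IsClosedForm t ∧
        RobinInterval.IsAssociatedOperator t (RobinInterval.similar Ω H) := by
  intro H
  obtain ⟨Ω, hL, hM, hΩ, hd⟩ := exists_similarity ha hα
  have hsim : similar Ω H = hOp a α := similar_eq_hOp ha hα Ω hΩ hd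
  -- The graph of the adjoint is described through density of the domain of `H`, which contains the
  -- image under `Ω⁻¹` of the dense domain of `h`.
  have hdense : Dense (H.domain : Set (L2 a)) := by
    have h1 : Dense ((similar Ω H).domain : Set (L2 a)) := by
      rw [hsim]
      exact dense_hOp_domain ha
    refine (Ω.symm.surjective.denseRange.dense_image Ω.symm.continuous h1).mono ?_
    rintro _ ⟨u, hu, rfl⟩
    exact hu
  refine ⟨fun n => ?_, fun n => ?_, fun m n => ?_, Ω, hasSum_similarity ha hα Ω hΩ,
    hasSum_psi ha Ω hΩ, hL, hM, hsim, ?_, fun n => ?_, dense_W12 ha, formH a α, formH_self,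
    isClosedForm_formH a α, ?_⟩
  · rw [robin_graph]
    exact psi_mem_robinGraph ha α n
  · rw [LinearPMap.adjoint_graph_eq_graph_adjoint hdense, Submodule.mem_adjoint_iff]
    intro f g hfg
    rw [robin_graph] at hfg
    have h1 := robinGraph_inner ha hfg (by
      rw [map_mul, Complex.conj_I, Complex.conj_ofReal, neg_mul]
      exact phi_mem_robinGraph ha α n)
    have h2 := congrArg (starRingEnd ℂ) h1
    rw [inner_conj_symm, inner_conj_symm] at h2
    rw [h2, sub_self]
  · rw [← inner_conj_symm, inner_phi_psi ha hα]
    by_cases h : m = n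
    · simp [h]
    · simp [h, Ne.symm h]
  · rw [hsim]
    exact isSelfAdjoint_hOp ha
  · rw [hsim]
    exact chiN_mem_hOp_graph ha n
  · rw [hsim]
    exact isAssociatedOperator_hOp ha
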